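/- Let $f:\mathbb R\to\mathbb R$ be piecewise smooth: $\mathbb R$ is a disjoint union of finitely many intervals, on each of which $f$ is continuously differentiable and either strictly monotonic or constant. Let $Z,N\sim\mathcal N(0,1)$ be independent and suppose the Shannon entropy $H(\lfloor f(Z)\rfloor)$ is finite. Let $\delta>1$ and let $\lambda$ be a random variable with law $P_\lambda$ supported in a compact interval $[a,b]$, $a>0$, with $\mathbb E[\lambda]=\delta$. For $v\in(0,1]$ put $$\mathsf{mmse}_z(v)=\mathbb E\Big[\big(Z-\mathbb E[Z\mid \sqrt{v^{-1}-1}\,Z+N,\ f(Z)]\big)^2\Big],\qquad \phi(v)=\Big(\tfrac1{\mathsf{mmse}_z(v)}-\tfrac1v\Big)^{-1}\in[0,\infty]$$ (with $1/0=\infty$, $1/\infty=0$), and $\phi(0)=\lim_{v\downarrow0}\phi(v)$. For $V\in[0,\infty]$ put $$\mathsf{MSE}_\lambda(V)=\mathbb E\Big[\tfrac{V}{V+\lambda}\Big],\qquad \Phi(V)=\Big(\tfrac{1}{\frac1\delta\mathbb E[V\lambda/(V+\lambda)]}-\tfrac1V\Big)^{-1},$$ where $\mathsf{MSE}_\lambda(\infty)=1$,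 $\Phi(0)=0$, $\Phi(\infty)=1$. The state evolution of GLM-EP is $V_l^t=\phi(V_r^{t-1})$, $V_r^t=\Phi(V_l^t)$ for $t\ge0$, with $V_r^{-1}=1$. Let $$P(v)=\mathbb E\Big[\tfrac{\phi(v)}{\phi(v)+\lambda}\Big]-\Big[1-\delta\Big(1-\tfrac{\mathsf{mmse}_z(v)}{v}\Big)\Big],\qquad V_r^\star=\inf\{v\in[0,1]: P(u)>0\ \ \forall u\in[v,1]\},$$ with $V_r^\star=1$ if this set is empty, and let the predicted final MSE be $\mathsf{MSE}_\lambda^\star=\mathsf{MSE}_\lambda(\phi(V_r^\star))$. Then: 1. $\mathsf{MSE}^\star_\lambda=\lim_{t\to\infty}\mathsf{MSE}_\lambda(V_l^t)$, and $\mathsf{MSE}^\star_\lambda=0$ if and only if $P(v)>0$ for all $v\in(0,1]$. 2. Suppose moreover that, for Lebesgue-almost every $z$ with $f'(z)=0$, $f$ is constant in a neighbourhood of $z$ (so that $f(Z)$ has a mixed discrete and absolutely continuous law). Then the information dimension $d(f(Z))=\lim_{M\to\infty}H(\lfloor M f(Z)\rfloor/M)/\log M$ exists, and a necessary condition for $P(v)>0$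 for all $v\in(0,1]$ is $\delta\ge 1/d(f(Z))$ (with $1/0=\infty$). So GLM-EP cannot reconstruct perfectly below the information-theoretic threshold $1/d(f(Z))$. -/

import Mathlib

open MeasureTheory ProbabilityTheory Filter Topology Set
open scoped ENNReal

namespace GLMEP

noncomputable section

/-- Shannon entropy (in nats, valued in `[0, ∞]`) of a discrete distribution:
`∑ₐ -p(a) log p(a)` with `p(a) = μ {a}`. -/
def shannonEntropy {α : Type*} [MeasurableSpace α] (μ : Measure α) : ℝ≥0∞ :=
  ∑' a : α, ENNReal.ofReal (Real.negMulLog (μ.real {a}))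

/-- The quantization operator `⟨x⟩_M = ⌊M x⌋ / M`. -/
def quantize (M : ℕ) (x : ℝ) : ℝ := (⌊(M : ℝ) * x⌋ : ℝ) / (M : ℝ)

/-- `d` is the (Rényi) information dimension of the real random variable with law `μ`:
`H(⟨X⟩_M) / log M → d` as `M → ∞`. -/
def HasInformationDimension (μ : Measure ℝ) (d : ℝ≥0∞) : Prop :=
  Tendsto (fun M : ℕ => shannonEntropy (μ.map (quantize M)) / ENNReal.ofReal (Real.log M))
    atTop (𝓝 d)

/-- The conditional MMSE `E[(Z - E[Z | √snr Z + N, U])²]`. -/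
def condMMSE {Ω : Type*} [MeasurableSpace Ω] (μ : Measure Ω) (Z N U : Ω → ℝ) (snr : ℝ) : ℝ :=
  ∫ ω, (Z ω - (μ[Z | MeasurableSpace.comap (fun ω' => (Real.sqrt snr * Z ω' + N ω', U ω'))
    inferInstance]) ω) ^ 2 ∂μ

/-- `mmse_z(v) = mmse(Z, 1/v - 1 | f(Z))` for `v ∈ (0, 1]`, where `Z`, `N` are independent standard
Gaussians, realized as the two coordinates of `ℝ × ℝ`. -/
def mmseZ (f : ℝ → ℝ) (v : ℝ) : ℝ :=
  condMMSE ((gaussianReal 0 1).prod (gaussianReal 0 1))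
    (fun p : ℝ × ℝ => p.1) (fun p => p.2) (fun p => f p.1) (v⁻¹ - 1)

/-- `(1 / mmse_z(v) - 1 / v)⁻¹` in `[0, ∞]`, for `v ∈ (0, 1]`, with `1/0 = ∞` and `1/∞ = 0`
(so the value is `0` if `mmse_z(v) = 0`, and `∞` if `mmse_z(v) = v`). -/
def phiPos (f : ℝ → ℝ) (v : ℝ) : ℝ≥0∞ :=
  ((ENNReal.ofReal (mmseZ f v))⁻¹ - (ENNReal.ofReal v)⁻¹)⁻¹

/-- The state evolution map `φ` on `[0, 1]`, with `φ(0) = lim_{v ↓ 0} φ(v)`. (The limit exists since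
`φ` is nondecreasing on `(0, 1]`.) -/
def phi (f : ℝ → ℝ) (v : ℝ) : ℝ≥0∞ :=
  if v = 0 then limUnder (𝓝[>] (0 : ℝ)) (phiPos f) else phiPos f v

/-- `V / (V + l)` for `V ∈ [0, ∞]` and `l > 0`; its value at `V = ∞` is the limit `1`. -/
def ratio (V : ℝ≥0∞) (l : ℝ) : ℝ :=
  if V = ⊤ then 1 else V.toReal / (V.toReal + l)

/-- `V l / (V + l)` for `V ∈ [0, ∞]` and `l > 0`; its value at `V = ∞` is the limit `l`. -/
def harm (V : ℝ≥0∞) (l : ℝ) : ℝ :=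
  if V = ⊤ then l else V.toReal * l / (V.toReal + l)

/-- `MSE_λ(V) = E[V / (V + λ)]`, where `λ` has law `Pl`. -/
def mse (Pl : Measure ℝ) (V : ℝ≥0∞) : ℝ := ∫ l, ratio V l ∂Pl

/-- The state evolution map `Φ(V) = (1 / ((1/δ) E[V λ / (V + λ)]) - 1 / V)⁻¹` for `V ∈ (0, ∞]`
(with `1 / ∞ = 0`), extended continuously by `Φ(0) = 0`. -/
def Phi (Pl : Measure ℝ) (δ : ℝ) (V : ℝ≥0∞) : ℝ :=
  if V = 0 then 0 else (1 / ((1 / δ) * ∫ l, harm V l ∂Pl) - (V⁻¹).toReal)⁻¹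

/-- The state evolution recursion, started from `V_r^{-1} = 1`. -/
structure IsStateEvolution (f : ℝ → ℝ) (Pl : Measure ℝ) (δ : ℝ)
    (Vl : ℕ → ℝ≥0∞) (Vr : ℕ → ℝ) : Prop where
  left_zero : Vl 0 = phi f 1
  left_succ : ∀ t, Vl (t + 1) = phi f (Vr t)
  right : ∀ t, Vr t = Phi Pl δ (Vl t)

/-- `P(v) = E[φ(v) / (φ(v) + λ)] - [1 - δ (1 - mmse_z(v) / v)]`, for `v ∈ (0, 1]`. -/
def PFun (f : ℝ → ℝ) (Pl : Measure ℝ) (δ : ℝ) (v : ℝ) : ℝ :=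
  mse Pl (phi f v) - (1 - δ * (1 - mmseZ f v / v))

/-- The set `{v ∈ [0, 1] : P(u) > 0 for all u ∈ [v, 1]}`. (Its infimum does not depend on the
value of `P` at `0`.) -/
def goodSet (f : ℝ → ℝ) (Pl : Measure ℝ) (δ : ℝ) : Set ℝ :=
  {v | v ∈ Icc (0 : ℝ) 1 ∧ ∀ u ∈ Icc v 1, 0 < PFun f Pl δ u}

open Classical in
/-- `V_r^⋆ = inf {v ∈ [0, 1] : P(u) > 0 for all u ∈ [v, 1]}`, and `V_r^⋆ = 1` in the degenerate
case where this set is empty. -/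
def VrStar (f : ℝ → ℝ) (Pl : Measure ℝ) (δ : ℝ) : ℝ :=
  if (goodSet f Pl δ).Nonempty then sInf (goodSet f Pl δ) else 1

/-- The predicted final MSE, `MSE_λ^⋆ = MSE_λ(φ(V_r^⋆))`. -/
def finalMSE (f : ℝ → ℝ) (Pl : Measure ℝ) (δ : ℝ) : ℝ :=
  mse Pl (phi f (VrStar f Pl δ))

/-- `f` is piecewise smooth: `ℝ` is a disjoint union of finitely many intervals (points allowed),
on each of which `f` is continuously differentiable and either strictly monotonic or constant. -/
def PiecewiseSmooth (f : ℝ → ℝ) : Prop :=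
  ∃ (K : ℕ) (I : Fin K → Set ℝ),
    (∀ i, (I i).OrdConnected) ∧ Pairwise (fun i j => Disjoint (I i) (I j)) ∧
    (⋃ i, I i) = univ ∧
    ∀ i, ContDiffOn ℝ 1 f (I i) ∧
      (StrictMonoOn f (I i) ∨ StrictAntiOn f (I i) ∨ ∃ c, ∀ x ∈ I i, f x = c)

/-- Up to a Lebesgue-null set, `f'` vanishes only inside the flat sections of `f`. For a piecewise
smooth `f` this says that `f(Z)`, `Z` Gaussian, has a mixed discrete / absolutely continuous law,
the discrete part coming from the flat sections. -/
def CriticalOnlyOnFlat (f : ℝ → ℝ) : Prop :=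
  ∀ᵐ z : ℝ, deriv f z = 0 → ∀ᶠ u in 𝓝 z, f u = f z

end

end GLMEP

/-! Put `T = Φ ∘ φ`. Both factors are monotone for the same reason. The MMSE `M(s)` satisfies
`1/M(s+Δ) ≥ 1/M(s) + Δ`, because the optimal estimator at strength `s` can be combined linearly with
a further independent observation of strength `Δ` (`gaussMMSE_add_le`); this says that `1/mmse_z(v)
- 1/v` is nonincreasing in `v`. The same computation for the scalar Gaussian MMSEs `l/(1 + t l)`,
averaged over `l`, handles `Φ` (`AdmissibleLaw.inv_harmMean_add_le`). Moreover `φ` is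
right-continuous and `Φ` is continuous.

Algebra shows that `P(v) > 0` exactly when `T(v) < v` (`AdmissibleLaw.PFun_pos_iff`). Hence `T(u) <
u` above `V_r^⋆`, while monotonicity and minimality force `V_r^⋆ ≤ T(V_r^⋆)`, so the iterates of `T`
from `1` decrease to `V_r^⋆`. Since `MSE_λ` vanishes only at `0`, a zero final MSE forces `φ(V_r^⋆)
= 0` and so `V_r^⋆ ≤ Φ(0) = 0`; conversely `T(v) < v` on `(0, 1]` forces `V_r^⋆ = 0` and `φ(0) = 0`.

For the second part let `p` be the Gaussian mass of the set where `f` is locally constant. For small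
`v` the noisy observation localizes `Z` at scale `√v`, and on that set `f(Z)` then adds nothing, so
`liminf mmse_z(v)/v ≥ p` (`eventually_le_mmseZ`). Letting `v ↓ 0` in `P(v) > 0`, with `φ(v) → 0`,
gives `1 ≤ δ(1 - p)`. The law of `f(Z)` is finitely supported on the flat part and absolutely
continuous off it, so Rényi's theorem (`hasInformationDimension_of_add`) identifies `d` as `1 - p`.
-/

namespace GLMEP

/-! ### The Gaussian channel -/

/-- The conditional expectation minimises the mean square error. -/
theorem integral_sub_condExp_sq_le {Ω : Type*} {m mΩ : MeasurableSpace Ω} {μ : Measure Ω}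
    [IsFiniteMeasure μ] (hm : m ≤ mΩ) {Z X : Ω → ℝ} (hZ : MemLp Z 2 μ) (hX : MemLp X 2 μ)
    (hXm : StronglyMeasurable[m] X) :
    ∫ ω, (Z ω - (μ[Z | m]) ω) ^ 2 ∂μ ≤ ∫ ω, (Z ω - X ω) ^ 2 ∂μ := by
  have hY : MemLp (Z - X) 2 μ := hZ.sub hX
  have h1 := condVar_ae_le_condExp_sq hm hY
  have h2 : μ[Z - X | m] =ᵐ[μ] μ[Z | m] - X := by
    have := condExp_sub (m := m) (hZ.integrable one_le_two) (hX.integrable one_le_two)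
    rwa [condExp_of_stronglyMeasurable hm hXm (hX.integrable one_le_two)] at this
  have h3 : ∫ ω, (Var[Z - X; μ | m]) ω ∂μ = ∫ ω, (Z ω - (μ[Z | m]) ω) ^ 2 ∂μ := by
    rw [condVar, integral_condExp hm]
    refine integral_congr_ae ?_
    filter_upwards [h2] with ω hω
    simp [hω]
  rw [← h3]
  calc ∫ ω, (Var[Z - X; μ | m]) ω ∂μ ≤ ∫ ω, (μ[(Z - X) ^ 2 | m]) ω ∂μ :=
        integral_mono_ae integrable_condVar integrable_condExp h1
    _ = ∫ ω, (Z ω - X ω) ^ 2 ∂μ := by rw [integral_condExp hm]; rfl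

/-- The law of two independent standard Gaussians. -/
noncomputable abbrev gaussPair : Measure (ℝ × ℝ) := (gaussianReal 0 1).prod (gaussianReal 0 1)

theorem map_rotate_gaussPair {a b : ℝ} (hab : a ^ 2 + b ^ 2 = 1) :
    gaussPair.map (fun p : ℝ × ℝ => (a * p.1 - b * p.2, b * p.1 + a * p.2)) = gaussPair := by
  obtain ⟨θ, ha, hb⟩ : ∃ θ : ℝ, a = Real.cos θ ∧ b = Real.sin θ := by
    have hn : ‖(⟨a, b⟩ : ℂ)‖ = 1 := by
      rw [Complex.norm_def, Complex.normSq_mk, Real.sqrt_eq_one]; nlinarith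
    have h0 : (⟨a, b⟩ : ℂ) ≠ 0 := by
      intro h; rw [h] at hn; simp at hn
    refine ⟨Complex.arg ⟨a, b⟩, ?_, ?_⟩
    · rw [Complex.cos_arg h0, hn]; simp
    · rw [Complex.sin_arg, hn]; simp
  have h := IsGaussian.map_rotation_eq_self (μ := gaussianReal 0 1)
    (by simp) (-θ)
  conv_rhs => rw [gaussPair, ← h]
  congr 1
  ext p <;> simp [ContinuousLinearMap.rotation_apply, ha, hb]; ring

theorem measurePreserving_rotate {a b : ℝ} (hab : a ^ 2 + b ^ 2 = 1) :
    MeasurePreserving (fun p : ℝ × ℝ => (a * p.1 - b * p.2, b * p.1 + a * p.2))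
      gaussPair gaussPair :=
  ⟨by fun_prop, map_rotate_gaussPair hab⟩

/-- The pair `(√s Z + N, f(Z))` observed by the estimator. -/
noncomputable def channel (f : ℝ → ℝ) (s : ℝ) (p : ℝ × ℝ) : ℝ × ℝ :=
  (Real.sqrt s * p.1 + p.2, f p.1)

@[fun_prop]
theorem measurable_channel {f : ℝ → ℝ} (hf : Measurable f) (s : ℝ) : Measurable (channel f s) := by
  unfold channel; fun_prop

/-- The minimum mean square error of `Z` given `(√s Z + N, f(Z))`. -/
noncomputable def gaussMMSE (f : ℝ → ℝ) (s : ℝ) : ℝ :=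
  condMMSE gaussPair (fun p => p.1) (fun p => p.2) (fun p => f p.1) s

theorem mmseZ_eq (f : ℝ → ℝ) (v : ℝ) : mmseZ f v = gaussMMSE f (v⁻¹ - 1) := rfl

theorem gaussMMSE_nonneg (f : ℝ → ℝ) (s : ℝ) : 0 ≤ gaussMMSE f s :=
  integral_nonneg fun _ => sq_nonneg _

theorem memLp_fst_gaussPair : MemLp (fun p : ℝ × ℝ => p.1) 2 gaussPair :=
  (memLp_id_gaussianReal (μ := 0) (v := 1) 2).comp_measurePreserving measurePreserving_fst

/-- Stated in `[0, ∞]` so that no integrability is asked of `g`: an infinite error is trivial, and a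
finite one puts the estimator in `L²`. -/
theorem ofReal_gaussMMSE_le {f : ℝ → ℝ} (hf : Measurable f) (s : ℝ) {g : ℝ × ℝ → ℝ}
    (hg : Measurable g) :
    ENNReal.ofReal (gaussMMSE f s) ≤
      ∫⁻ p, ENNReal.ofReal ((p.1 - g (channel f s p)) ^ 2) ∂gaussPair := by
  by_cases htop : ∫⁻ p, ENNReal.ofReal ((p.1 - g (channel f s p)) ^ 2) ∂gaussPair = ⊤
  · rw [htop]; exact le_top
  have hmeas : Measurable fun p : ℝ × ℝ => p.1 - g (channel f s p) := by fun_prop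
  have hint : Integrable (fun p : ℝ × ℝ => (p.1 - g (channel f s p)) ^ 2) gaussPair :=
    (lintegral_ofReal_ne_top_iff_integrable (by fun_prop)
      (ae_of_all _ fun _ => sq_nonneg _)).1 htop
  have hL : MemLp (fun p : ℝ × ℝ => p.1 - g (channel f s p)) 2 gaussPair :=
    (memLp_two_iff_integrable_sq hmeas.aestronglyMeasurable).2 hint
  have hgL : MemLp (fun p : ℝ × ℝ => g (channel f s p)) 2 gaussPair := by
    have := memLp_fst_gaussPair.sub hL
    simpa [Pi.sub_def] using this
  rw [← ofReal_integral_eq_lintegral_ofReal hint (ae_of_all _ fun _ => sq_nonneg _)]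
  refine ENNReal.ofReal_le_ofReal (integral_sub_condExp_sq_le ?_ memLp_fst_gaussPair hgL ?_)
  · exact (measurable_channel hf s).comap_le
  · exact (hg.comp (comap_measurable (channel f s))).stronglyMeasurable

/-- By Doob–Dynkin the conditional expectation is a function of the observation, so the minimum is
attained by an explicit estimator. -/
theorem exists_ofReal_gaussMMSE_eq (f : ℝ → ℝ) (s : ℝ) :
    ∃ g : ℝ × ℝ → ℝ, Measurable g ∧ MemLp (fun p => g (channel f s p)) 2 gaussPair ∧
      ENNReal.ofReal (gaussMMSE f s) =
        ∫⁻ p, ENNReal.ofReal ((p.1 - g (channel f s p)) ^ 2) ∂gaussPair := by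
  obtain ⟨g, hg, hgeq⟩ := StronglyMeasurable.exists_eq_measurable_comp (f := channel f s)
    (stronglyMeasurable_condExp (f := fun p : ℝ × ℝ => p.1) (μ := gaussPair))
  have hL : MemLp (fun p => g (channel f s p)) 2 gaussPair := by
    change MemLp (g ∘ channel f s) 2 gaussPair
    rw [← hgeq]
    exact memLp_fst_gaussPair.condExp one_le_two
  refine ⟨g, hg.measurable, hL, ?_⟩
  have hint : Integrable (fun p : ℝ × ℝ => (p.1 - g (channel f s p)) ^ 2) gaussPair :=
    (memLp_fst_gaussPair.sub hL).integrable_sq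
  rw [← ofReal_integral_eq_lintegral_ofReal hint (ae_of_all _ fun _ => sq_nonneg _)]
  congr 1
  refine integral_congr_ae (ae_of_all _ fun p => ?_)
  have := congrFun hgeq p
  simp only [Function.comp] at this
  simp only
  rw [← this]
  rfl

theorem integrable_id_gauss : Integrable (fun x : ℝ => x) (gaussianReal 0 1) :=
  (memLp_id_gaussianReal (μ := 0) (v := 1) 1).integrable le_rfl

theorem integrable_sq_gauss : Integrable (fun x : ℝ => x ^ 2) (gaussianReal 0 1) :=
  (memLp_id_gaussianReal (μ := 0) (v := 1) 2).integrable_sq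

theorem integral_sq_gauss : ∫ x, x ^ 2 ∂(gaussianReal 0 1) = 1 := by
  have h := variance_fun_id_gaussianReal (μ := 0) (v := 1)
  rw [variance_eq_sub (X := fun x => x) (memLp_id_gaussianReal 2)] at h
  simpa [integral_id_gaussianReal] using h

theorem lintegral_affine_sq (c d : ℝ) :
    ∫⁻ x, ENNReal.ofReal ((c - d * x) ^ 2) ∂(gaussianReal 0 1) =
      ENNReal.ofReal (c ^ 2 + d ^ 2) := by
  have e : (fun x : ℝ => (c - d * x) ^ 2) = fun x => (c ^ 2 - (2 * c * d) * x) + d ^ 2 * x ^ 2 := by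
    ext x; ring
  have i1 : Integrable (fun x : ℝ => c ^ 2 - (2 * c * d) * x) (gaussianReal 0 1) :=
    (integrable_const _).sub (integrable_id_gauss.const_mul (2 * c * d))
  have i2 := integrable_sq_gauss.const_mul (d ^ 2)
  rw [← ofReal_integral_eq_lintegral_ofReal (by rw [e]; exact i1.add i2)
    (ae_of_all _ fun _ => sq_nonneg _), e, integral_add i1 i2, integral_sub (integrable_const _)
    (integrable_id_gauss.const_mul _), integral_const_mul, integral_const_mul, integral_sq_gauss,
    integral_id_gaussianReal]
  simp

theorem lintegral_lintegral_rotate {a b : ℝ} (hab : a ^ 2 + b ^ 2 = 1) {F : ℝ × ℝ → ℝ≥0∞}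
    (hF : Measurable F) :
    ∫⁻ t, ∫⁻ x, F (a * x - b * t, b * x + a * t) ∂(gaussianReal 0 1) ∂(gaussianReal 0 1) =
      ∫⁻ n, ∫⁻ n', F (n, n') ∂(gaussianReal 0 1) ∂(gaussianReal 0 1) := by
  have hm : Measurable fun q : ℝ × ℝ => F (a * q.1 - b * q.2, b * q.1 + a * q.2) :=
    hF.comp (measurePreserving_rotate hab).measurable
  rw [← lintegral_prod_symm _ hm.aemeasurable, ← lintegral_prod _ hF.aemeasurable]
  exact (measurePreserving_rotate hab).lintegral_comp hF

/-- Here `x` is the noise of a combined observation and `t` is independent randomness available to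
the estimator. A bound valid for each fixed `t` survives averaging, and the rotated pair is again a
pair of independent standard noises. -/
theorem le_lintegral_of_forall_rotate {a b : ℝ} (hab : a ^ 2 + b ^ 2 = 1)
    {F : ℝ × ℝ × ℝ → ℝ≥0∞} (hF : Measurable F) {C : ℝ≥0∞}
    (hC : ∀ t, C ≤ ∫⁻ z, ∫⁻ x, F (z, a * x - b * t, b * x + a * t) ∂(gaussianReal 0 1)
      ∂(gaussianReal 0 1)) :
    C ≤ ∫⁻ z, ∫⁻ n, ∫⁻ n', F (z, n, n') ∂(gaussianReal 0 1) ∂(gaussianReal 0 1)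
      ∂(gaussianReal 0 1) := by
  calc C = ∫⁻ _t, C ∂(gaussianReal 0 1) := by simp
    _ ≤ ∫⁻ t, ∫⁻ z, ∫⁻ x, F (z, a * x - b * t, b * x + a * t) ∂(gaussianReal 0 1)
          ∂(gaussianReal 0 1) ∂(gaussianReal 0 1) := lintegral_mono hC
    _ = ∫⁻ z, ∫⁻ t, ∫⁻ x, F (z, a * x - b * t, b * x + a * t) ∂(gaussianReal 0 1)
          ∂(gaussianReal 0 1) ∂(gaussianReal 0 1) := by
        refine lintegral_lintegral_swap (Measurable.aemeasurable ?_)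
        exact Measurable.lintegral_prod_right' (f := fun q : (ℝ × ℝ) × ℝ =>
          F (q.1.2, a * q.2 - b * q.1.1, b * q.2 + a * q.1.1)) (by fun_prop)
    _ = _ := lintegral_congr fun z => lintegral_lintegral_rotate hab (F := fun q => F (z, q))
          (hF.comp measurable_prodMk_left)

/-- Improving an estimator with an additional independent Gaussian observation of strength `Δ`. -/
theorem ofReal_gaussMMSE_add_le {f : ℝ → ℝ} (hf : Measurable f) {s Δ : ℝ} (hs : 0 ≤ s)
    (hΔ : 0 < Δ) (c : ℝ) :
    ENNReal.ofReal (gaussMMSE f (s + Δ)) ≤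
      ENNReal.ofReal ((1 - c * Δ) ^ 2) * ENNReal.ofReal (gaussMMSE f s)
        + ENNReal.ofReal (c ^ 2 * Δ) := by
  obtain ⟨g, hg, -, hgeq⟩ := exists_ofReal_gaussMMSE_eq f s
  have hs2 : 0 < Real.sqrt (s + Δ) := Real.sqrt_pos.2 (by linarith)
  have hsq2 : Real.sqrt (s + Δ) ^ 2 = s + Δ := Real.sq_sqrt (by linarith)
  have hsq : Real.sqrt s ^ 2 = s := Real.sq_sqrt hs
  have hsqΔ : Real.sqrt Δ ^ 2 = Δ := Real.sq_sqrt hΔ.le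
  -- With these weights `y = √(s+Δ) Z + x` splits into `a y - b t = √s Z + n` and `b y + a t = √Δ Z
  -- + n'` with independent noises.
  obtain ⟨a, ha⟩ : ∃ a, a * Real.sqrt (s + Δ) = Real.sqrt s :=
    ⟨Real.sqrt s / Real.sqrt (s + Δ), div_mul_cancel₀ _ hs2.ne'⟩
  obtain ⟨b, hb⟩ : ∃ b, b * Real.sqrt (s + Δ) = Real.sqrt Δ :=
    ⟨Real.sqrt Δ / Real.sqrt (s + Δ), div_mul_cancel₀ _ hs2.ne'⟩
  have hab : a ^ 2 + b ^ 2 = 1 := by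
    have : (a ^ 2 + b ^ 2 - 1) * Real.sqrt (s + Δ) ^ 2 = 0 := by
      have : (a * Real.sqrt (s + Δ)) ^ 2 + (b * Real.sqrt (s + Δ)) ^ 2
        - Real.sqrt (s + Δ) ^ 2 = 0 := by rw [ha, hb, hsq, hsqΔ, hsq2]; ring
      linarith
    rcases mul_eq_zero.1 this with h | h
    · linarith
    · exact absurd h (by positivity)
  have hch : Measurable fun q : ℝ × ℝ × ℝ => g (channel f s (q.1, q.2.1)) := by
    unfold channel; fun_prop
  -- `F` is the squared error of the estimator `(1 - cΔ) g + c√Δ (√Δ Z + n')`.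
  have key := le_lintegral_of_forall_rotate hab (C := ENNReal.ofReal (gaussMMSE f (s + Δ)))
    (F := fun q : ℝ × ℝ × ℝ => ENNReal.ofReal
      (((1 - c * Δ) * (q.1 - g (channel f s (q.1, q.2.1))) - c * Real.sqrt Δ * q.2.2) ^ 2))
    (by fun_prop) (fun t => ?_)
  · refine key.trans (le_of_eq ?_)
    simp only [lintegral_affine_sq]
    rw [← lintegral_prod (μ := gaussianReal 0 1) (ν := gaussianReal 0 1)
      (fun p : ℝ × ℝ => ENNReal.ofReal (((1 - c * Δ) * (p.1 - g (channel f s (p.1, p.2)))) ^ 2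
        + (c * Real.sqrt Δ) ^ 2)) (by fun_prop), hgeq, ← lintegral_const_mul _ (by fun_prop)]
    have e : ∀ p : ℝ × ℝ, ENNReal.ofReal (((1 - c * Δ) * (p.1 - g (channel f s (p.1, p.2)))) ^ 2
        + (c * Real.sqrt Δ) ^ 2) = ENNReal.ofReal ((1 - c * Δ) ^ 2) *
          ENNReal.ofReal ((p.1 - g (channel f s p)) ^ 2) + ENNReal.ofReal (c ^ 2 * Δ) := by
      intro p
      rw [ENNReal.ofReal_add (sq_nonneg _) (sq_nonneg _), mul_pow, mul_pow, hsqΔ,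
        ENNReal.ofReal_mul (sq_nonneg _)]
    rw [lintegral_congr e, lintegral_add_right _ measurable_const]
    simp
  · have hG : Measurable fun y : ℝ × ℝ =>
        (1 - c * Δ) * g (a * y.1 - b * t, y.2) + c * Real.sqrt Δ * (b * y.1 + a * t) := by
      fun_prop
    refine (ofReal_gaussMMSE_le hf (s + Δ) hG).trans (le_of_eq ?_)
    rw [lintegral_prod _ (by fun_prop)]
    refine lintegral_congr fun z => lintegral_congr fun x => ?_
    simp only [channel]
    have e1 : a * (Real.sqrt (s + Δ) * z + x) - b * t = Real.sqrt s * z + (a * x - b * t) := by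
      rw [← ha]; ring
    have e2 : b * (Real.sqrt (s + Δ) * z + x) + a * t = Real.sqrt Δ * z + (b * x + a * t) := by
      rw [← hb]; ring
    rw [e1, e2]
    congr 2
    linear_combination (-c * z) * hsqΔ

theorem gaussMMSE_le_one {f : ℝ → ℝ} (hf : Measurable f) (s : ℝ) : gaussMMSE f s ≤ 1 := by
  have h := ofReal_gaussMMSE_le hf s (g := fun _ => 0) measurable_const
  have h2 : ∫⁻ p : ℝ × ℝ, ENNReal.ofReal ((p.1 - 0) ^ 2) ∂gaussPair = 1 := by
    rw [lintegral_prod _ (by fun_prop)]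
    have := lintegral_affine_sq 0 1
    simpa using this
  rw [h2] at h
  simpa using h

/-- The choice `c = m/(1 + Δm)` minimises `(1 - cΔ)² m + c²Δ`, with minimum `m/(1 + Δm)`. The
product form remains meaningful when an MMSE vanishes. -/
theorem gaussMMSE_add_le {f : ℝ → ℝ} (hf : Measurable f) {s Δ : ℝ} (hs : 0 ≤ s)
    (hΔ : 0 ≤ Δ) : gaussMMSE f (s + Δ) * (1 + Δ * gaussMMSE f s) ≤ gaussMMSE f s := by
  rcases hΔ.eq_or_lt with rfl | hΔ
  · simp
  have hm := gaussMMSE_nonneg f s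
  set m := gaussMMSE f s with hmdef
  have hpos : 0 < 1 + Δ * m := by positivity
  set c := m / (1 + Δ * m) with hc
  have h := ofReal_gaussMMSE_add_le hf hs hΔ c
  rw [← ENNReal.ofReal_mul (sq_nonneg _), ← ENNReal.ofReal_add (by positivity) (by positivity),
    ENNReal.ofReal_le_ofReal_iff (by positivity)] at h
  calc _ ≤ ((1 - c * Δ) ^ 2 * m + c ^ 2 * Δ) * (1 + Δ * m) := by gcongr
    _ = m := by rw [hc]; field_simp; ring

theorem gaussMMSE_antitone {f : ℝ → ℝ} (hf : Measurable f) {s t : ℝ} (hs : 0 ≤ s) (hst : s ≤ t) :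
    gaussMMSE f t ≤ gaussMMSE f s := by
  have h := gaussMMSE_add_le hf hs (sub_nonneg.2 hst)
  have h1 := gaussMMSE_nonneg f t
  have h2 := gaussMMSE_nonneg f s
  rw [add_sub_cancel] at h
  nlinarith [mul_nonneg h1 (mul_nonneg (sub_nonneg.2 hst) h2)]

/-- Upper semicontinuity: a bounded continuous estimator that is nearly optimal at `s₀` has an error
continuous in `s`, and this error dominates the MMSE for every `s`. -/
theorem eventually_gaussMMSE_lt {f : ℝ → ℝ} (hf : Measurable f) (s₀ : ℝ) {ε : ℝ} (hε : 0 < ε) :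
    ∀ᶠ s in 𝓝 s₀, gaussMMSE f s < gaussMMSE f s₀ + ε := by
  obtain ⟨g, hg, hgL, hgeq⟩ := exists_ofReal_gaussMMSE_eq f s₀
  have hch := measurable_channel hf s₀
  have hgν : MemLp g (ENNReal.ofReal 2) (gaussPair.map (channel f s₀)) := by
    rw [memLp_map_measure_iff hg.aestronglyMeasurable hch.aemeasurable]
    simpa [Function.comp_def] using hgL
  -- From `(x + y)² ≤ (1 + η)x² + (1 + 1/η)y²` and MMSE at most `1`, the excess is at most `2η < ε`.
  set η := ε / 3 with hη
  have hη0 : 0 < η := by positivity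
  obtain ⟨h, hh, hhL⟩ := hgν.exists_boundedContinuous_integral_rpow_sub_le two_pos
    (ε := η / (1 + 1 / η)) (by positivity)
  have : IsFiniteMeasure (gaussPair.map (channel f s₀)) := inferInstance
  rw [integral_map hch.aemeasurable
    (by exact (((hg.sub h.continuous.measurable).norm).pow_const _).aestronglyMeasurable)] at hh
  have hhc : Continuous h := h.continuous
  have hb : ∀ p, ‖h p‖ ≤ ‖h‖ := h.norm_coe_le_norm
  have hcont : Continuous fun s => ∫ p, (p.1 - h (channel f s p)) ^ 2 ∂gaussPair := by
    refine continuous_of_dominated (bound := fun p => 2 * p.1 ^ 2 + 2 * ‖h‖ ^ 2) ?_ ?_ ?_ ?_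
    · intro s
      have := measurable_channel hf s
      have := hhc.measurable
      exact Measurable.aestronglyMeasurable (by fun_prop)
    · intro s
      refine ae_of_all _ fun p => ?_
      have h1 := sq_le_sq' (neg_le_of_abs_le (hb (channel f s p))) (le_of_abs_le (hb (channel f s p)))
      rw [Real.norm_of_nonneg (sq_nonneg _)]
      nlinarith [sq_nonneg (p.1 + h (channel f s p))]
    · exact (memLp_fst_gaussPair.integrable_sq.const_mul 2).add (integrable_const _)
    · refine ae_of_all _ fun p => ?_
      simp only [channel]
      fun_prop
  have hle : ∀ s, gaussMMSE f s ≤ ∫ p, (p.1 - h (channel f s p)) ^ 2 ∂gaussPair := by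
    intro s
    have hb2 : MemLp (fun p => h (channel f s p)) 2 gaussPair :=
      MemLp.of_bound (hhc.measurable.comp (measurable_channel hf s)).aestronglyMeasurable ‖h‖
        (ae_of_all _ fun p => hb _)
    have hi : Integrable (fun p : ℝ × ℝ => (p.1 - h (channel f s p)) ^ 2) gaussPair :=
      (memLp_fst_gaussPair.sub hb2).integrable_sq
    have := ofReal_gaussMMSE_le hf s hhc.measurable
    rwa [← ofReal_integral_eq_lintegral_ofReal hi (ae_of_all _ fun _ => sq_nonneg _),
      ENNReal.ofReal_le_ofReal_iff (integral_nonneg fun _ => sq_nonneg _)] at this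
  have hlt : ∫ p, (p.1 - h (channel f s₀ p)) ^ 2 ∂gaussPair < gaussMMSE f s₀ + ε := by
    have hb2 : MemLp (fun p => h (channel f s₀ p)) 2 gaussPair :=
      MemLp.of_bound (hhc.measurable.comp hch).aestronglyMeasurable ‖h‖
        (ae_of_all _ fun p => hb _)
    have i1 : Integrable (fun p : ℝ × ℝ => (p.1 - g (channel f s₀ p)) ^ 2) gaussPair :=
      (memLp_fst_gaussPair.sub hgL).integrable_sq
    have i2 : Integrable (fun p : ℝ × ℝ => (g (channel f s₀ p) - h (channel f s₀ p)) ^ 2)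
      gaussPair := (hgL.sub hb2).integrable_sq
    have i3 : Integrable (fun p : ℝ × ℝ => (p.1 - h (channel f s₀ p)) ^ 2) gaussPair :=
      (memLp_fst_gaussPair.sub hb2).integrable_sq
    have hm : gaussMMSE f s₀ = ∫ p, (p.1 - g (channel f s₀ p)) ^ 2 ∂gaussPair := by
      rwa [← ofReal_integral_eq_lintegral_ofReal i1 (ae_of_all _ fun _ => sq_nonneg _),
        ENNReal.ofReal_eq_ofReal_iff (gaussMMSE_nonneg _ _)
        (integral_nonneg fun _ => sq_nonneg _)] at hgeq
    have hh' : ∫ p, (g (channel f s₀ p) - h (channel f s₀ p)) ^ 2 ∂gaussPair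
        ≤ η / (1 + 1 / η) := by
      simpa using hh
    have h1 : ∫ p, (p.1 - h (channel f s₀ p)) ^ 2 ∂gaussPair ≤
        (1 + η) * gaussMMSE f s₀ + (1 + 1 / η) *
          ∫ p, (g (channel f s₀ p) - h (channel f s₀ p)) ^ 2 ∂gaussPair := by
      rw [hm, ← integral_const_mul, ← integral_const_mul,
        ← integral_add (i1.const_mul _) (i2.const_mul _)]
      refine integral_mono i3 ((i1.const_mul _).add (i2.const_mul _)) fun p => ?_
      simp only
      set x := p.1 - g (channel f s₀ p)
      set y := g (channel f s₀ p) - h (channel f s₀ p)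
      have e : p.1 - h (channel f s₀ p) = x + y := by simp only [x, y]; ring
      rw [e]
      have e2 : (1 + η) * x ^ 2 + (1 + 1 / η) * y ^ 2 - (x + y) ^ 2 = (η * x - y) ^ 2 / η := by
        field_simp; ring
      have : 0 ≤ (η * x - y) ^ 2 / η := by positivity
      linarith
    have h2 : (1 + 1 / η) * ∫ p, (g (channel f s₀ p) - h (channel f s₀ p)) ^ 2 ∂gaussPair ≤ η := by
      rwa [mul_comm, ← le_div_iff₀ (by positivity)]
    nlinarith [gaussMMSE_le_one hf s₀, gaussMMSE_nonneg f s₀]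
  filter_upwards [(hcont.tendsto s₀).eventually (gt_mem_nhds hlt)] with s hs
  exact (hle s).trans_lt hs

/-! ### Flat sections and the small-variance behaviour of the MMSE -/

/-- The open set of points around which `f` is locally constant. -/
def flatSet (f : ℝ → ℝ) : Set ℝ := {z | ∀ᶠ u in 𝓝 z, f u = f z}

theorem isOpen_flatSet (f : ℝ → ℝ) : IsOpen (flatSet f) := by
  rw [isOpen_iff_mem_nhds]
  intro z hz
  have hz' : ∀ᶠ u in 𝓝 z, f u = f z := hz
  filter_upwards [hz'.eventually_nhds] with u hu
  filter_upwards [hu] with w hw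
  rw [hw, hu.self_of_nhds]

theorem eq_of_isPreconnected_subset_flatSet {f : ℝ → ℝ} {s : Set ℝ} (ho : IsOpen s)
    (hs : IsPreconnected s) (hsub : s ⊆ flatSet f) {x y : ℝ} (hx : x ∈ s) (hy : y ∈ s) :
    f x = f y := by
  have hd : ∀ z ∈ s, HasDerivAt f 0 z := fun z hz =>
    (hasDerivAt_const z (f z)).congr_of_eventuallyEq (hsub hz)
  exact ho.is_const_of_deriv_eq_zero hs
    (fun z hz => (hd z hz).differentiableAt.differentiableWithinAt)
    (fun z hz => (hd z hz).deriv) hx hy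

/-- Inner regularity gives `K`; compactness inside an open set gives one radius `η` for which every
ball around `K` stays in the flat set, and `f` is constant on such a connected ball. -/
theorem exists_isCompact_flat (f : ℝ → ℝ) {ε : ℝ} (hε : 0 < ε) :
    ∃ K : Set ℝ, IsCompact K ∧ (gaussianReal 0 1).real (flatSet f) - ε < (gaussianReal 0 1).real K ∧
      ∃ η > 0, ∀ y ∈ K, ∀ u, |u - y| < η → f u = f y := by
  obtain ⟨K, hKD, hK, hlt⟩ : ∃ K ⊆ flatSet f, IsCompact K ∧
      (gaussianReal 0 1).real (flatSet f) - ε < (gaussianReal 0 1).real K := by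
    by_cases h0 : gaussianReal 0 1 (flatSet f) = 0
    · exact ⟨∅, empty_subset _, isCompact_empty, by simp [measureReal_def, h0, hε]⟩
    obtain ⟨K, hKD, hK, hlt⟩ := (isOpen_flatSet f).exists_lt_isCompact
      (μ := gaussianReal 0 1)
      (ENNReal.sub_lt_self (measure_ne_top _ _) h0 (ENNReal.ofReal_pos.2 hε).ne')
    refine ⟨K, hKD, hK, ?_⟩
    have h1 := (ENNReal.toReal_lt_toReal (hlt.trans_le le_top).ne (measure_ne_top _ _)).2 hlt
    have h2 := ENNReal.le_toReal_sub (a := gaussianReal 0 1 (flatSet f))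
      (b := ENNReal.ofReal ε) ENNReal.ofReal_ne_top
    rw [ENNReal.toReal_ofReal hε.le] at h2
    exact h2.trans_lt h1
  obtain ⟨η, hη, hth⟩ := hK.exists_thickening_subset_open (isOpen_flatSet f) hKD
  refine ⟨K, hK, hlt, η, hη, fun y hy u hu => ?_⟩
  exact eq_of_isPreconnected_subset_flatSet Metric.isOpen_ball
    (convex_ball y η).isPreconnected ((Metric.ball_subset_thickening hy η).trans hth)
    (by rwa [Metric.mem_ball, Real.dist_eq]) (Metric.mem_ball_self hη)

theorem setIntegral_id_gauss (R : ℝ) : ∫ x in Icc (-R) R, x ∂(gaussianReal 0 1) = 0 := by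
  have hp : MeasurePreserving (fun x : ℝ => -x) (gaussianReal 0 1) (gaussianReal 0 1) :=
    ⟨measurable_neg, by rw [gaussianReal_map_neg, neg_zero]⟩
  have h := hp.setIntegral_preimage_emb (Homeomorph.neg ℝ).measurableEmbedding (fun x => x)
    (Icc (-R) R)
  have e : (fun x : ℝ => -x) ⁻¹' Icc (-R) R = Icc (-R) R := by
    ext x; simp only [mem_preimage, mem_Icc]; constructor <;> rintro ⟨h1, h2⟩ <;>
      constructor <;> linarith
  rw [e, integral_neg] at h
  linarith

/-- The second moment of a standard Gaussian truncated to `[-R, R]`. -/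
noncomputable def truncMoment (R : ℝ) : ℝ := ∫ x in Icc (-R) R, x ^ 2 ∂(gaussianReal 0 1)

theorem tendsto_truncMoment : Tendsto truncMoment atTop (𝓝 1) := by
  have h := (aecover_Icc (μ := gaussianReal 0 1) tendsto_neg_atTop_atBot
    tendsto_id).integral_tendsto_of_countably_generated integrable_sq_gauss
  rwa [integral_sq_gauss] at h

/-- The cross term integrates to zero over the symmetric interval, and the `t²` term is dropped. -/
theorem ofReal_truncMoment_le (R b t : ℝ) :
    ENNReal.ofReal (b ^ 2 * truncMoment R) ≤
      ∫⁻ w in Icc (-R) R, ENNReal.ofReal ((t - b * w) ^ 2) ∂(gaussianReal 0 1) := by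
  have e : (fun x : ℝ => (t - b * x) ^ 2) = fun x => (t ^ 2 - (2 * t * b) * x) + b ^ 2 * x ^ 2 := by
    ext x; ring
  have i0 : IntegrableOn (fun x : ℝ => x) (Icc (-R) R) (gaussianReal 0 1) :=
    integrable_id_gauss.integrableOn
  have i1 : IntegrableOn (fun x : ℝ => t ^ 2 - (2 * t * b) * x) (Icc (-R) R) (gaussianReal 0 1) :=
    (integrable_const _).sub (i0.const_mul (2 * t * b))
  have i2 : IntegrableOn (fun x : ℝ => b ^ 2 * x ^ 2) (Icc (-R) R) (gaussianReal 0 1) :=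
    (integrable_sq_gauss.const_mul _).integrableOn
  rw [← ofReal_integral_eq_lintegral_ofReal (by rw [e]; exact i1.add i2)
    (ae_of_all _ fun _ => sq_nonneg _), e, integral_add i1 i2, integral_sub (integrable_const _)
    (i0.const_mul _), integral_const_mul, integral_const_mul, setIntegral_id_gauss]
  refine ENNReal.ofReal_le_ofReal ?_
  rw [setIntegral_const, smul_eq_mul, truncMoment]
  have : 0 ≤ (gaussianReal 0 1).real (Icc (-R) R) * t ^ 2 := by positivity
  linarith

theorem truncMoment_nonneg (R : ℝ) : 0 ≤ truncMoment R :=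
  integral_nonneg fun _ => sq_nonneg _

/-- Rotate to `y`, proportional to the noisy observation, and an independent `w`, so that `Z = a y -
b w`. For `y ∈ K` and `|w| ≤ R` one has `f(Z) = f(y)`: the estimator sees only `y`, and the
truncated fluctuation of `b w` is irreducible error. -/
theorem le_gaussMMSE_of_flat {f : ℝ → ℝ} (hf : Measurable f) {K : Set ℝ} (hK : MeasurableSet K)
    {η a b R : ℝ} (hflat : ∀ y ∈ K, ∀ u, |u - y| < η → f u = f y) (ha : 0 ≤ a) (hb : 0 < b)
    (hab : a ^ 2 + b ^ 2 = 1)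
    (hη : ∀ y ∈ K, ∀ w ∈ Icc (-R) R, |a * y - b * w - y| < η) :
    b ^ 2 * truncMoment R * (gaussianReal 0 1).real K ≤ gaussMMSE f ((b ^ 2)⁻¹ - 1) := by
  have hs : Real.sqrt ((b ^ 2)⁻¹ - 1) = a / b := by
    have : (b ^ 2)⁻¹ - 1 = (a / b) ^ 2 := by
      field_simp; linarith
    rw [this, Real.sqrt_sq (by positivity)]
  obtain ⟨g, hg, -, hgeq⟩ := exists_ofReal_gaussMMSE_eq f ((b ^ 2)⁻¹ - 1)
  have hm : Measurable fun p : ℝ × ℝ =>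
      ENNReal.ofReal ((p.1 - g (channel f ((b ^ 2)⁻¹ - 1) p)) ^ 2) := by fun_prop
  rw [← (measurePreserving_rotate hab).lintegral_comp hm, lintegral_prod _
    (by exact (hm.comp (measurePreserving_rotate hab).measurable).aemeasurable)] at hgeq
  have hT := truncMoment_nonneg R
  rw [← ENNReal.ofReal_le_ofReal_iff (gaussMMSE_nonneg _ _), hgeq]
  calc ENNReal.ofReal (b ^ 2 * truncMoment R * (gaussianReal 0 1).real K)
      = ∫⁻ y in K, ENNReal.ofReal (b ^ 2 * truncMoment R) ∂(gaussianReal 0 1) := by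
        rw [setLIntegral_const, ENNReal.ofReal_mul (by positivity), ofReal_measureReal]
    _ ≤ ∫⁻ y in K, ∫⁻ w, ENNReal.ofReal ((a * y - b * w -
          g (channel f ((b ^ 2)⁻¹ - 1) (a * y - b * w, b * y + a * w))) ^ 2)
          ∂(gaussianReal 0 1) ∂(gaussianReal 0 1) := by
        refine setLIntegral_mono' hK fun y hy => ?_
        refine (ofReal_truncMoment_le R b (a * y - g (y / b, f y))).trans ?_
        refine le_trans (le_of_eq ?_) (setLIntegral_le_lintegral (Icc (-R) R) _)
        refine setLIntegral_congr_fun measurableSet_Icc fun w hw => ?_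
        simp only [channel]
        rw [hs, hflat y hy _ (hη y hy w hw)]
        have e : a / b * (a * y - b * w) + (b * y + a * w) = y / b := by
          have : y / b = (a ^ 2 + b ^ 2) * y / b := by rw [hab, one_mul]
          rw [this]; field_simp; ring
        rw [e]
        congr 2
        ring
    _ ≤ _ := setLIntegral_le_lintegral _ _

/-- On the flat sections of `f` the observation `f(Z)` is of no help in the small-variance limit. -/
theorem eventually_le_mmseZ {f : ℝ → ℝ} (hf : Measurable f) {ε : ℝ} (hε : 0 < ε) :
    ∀ᶠ v in 𝓝[>] (0 : ℝ), ((gaussianReal 0 1).real (flatSet f) - ε) * v ≤ mmseZ f v := by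
  obtain ⟨K, hK, hKlt, η, hη, hflat⟩ := exists_isCompact_flat f (half_pos hε)
  obtain ⟨R, hR⟩ := (tendsto_truncMoment.eventually
    (lt_mem_nhds (show 1 - ε / 2 < 1 by linarith))).exists
  obtain ⟨B, hB⟩ := hK.isBounded.exists_norm_le
  -- A bound for the displacement `|Z - y|` when `a = √(1-v)`, `b = √v`, `|y| ≤ B`, `|w| ≤ R`.
  have hlim : Tendsto (fun v : ℝ => (1 - Real.sqrt (1 - v)) * B + Real.sqrt v * R)
      (𝓝[>] 0) (𝓝 0) := by
    have : Continuous fun v : ℝ => (1 - Real.sqrt (1 - v)) * B + Real.sqrt v * R := by fun_prop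
    simpa using (this.tendsto 0).mono_left nhdsWithin_le_nhds
  filter_upwards [hlim.eventually (gt_mem_nhds hη), self_mem_nhdsWithin,
    nhdsWithin_le_nhds (gt_mem_nhds (zero_lt_one (α := ℝ)))] with v hv hv0 hv1
  have hv0' : 0 < v := hv0
  have hb2 : Real.sqrt v ^ 2 = v := Real.sq_sqrt hv0'.le
  have ha2 : Real.sqrt (1 - v) ^ 2 = 1 - v := Real.sq_sqrt (by linarith)
  have ha1 : Real.sqrt (1 - v) ≤ 1 := by rw [Real.sqrt_le_one]; linarith
  have h := le_gaussMMSE_of_flat hf hK.measurableSet (a := Real.sqrt (1 - v)) (b := Real.sqrt v)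
    (R := R) hflat (Real.sqrt_nonneg _) (Real.sqrt_pos.2 hv0') (by rw [hb2, ha2]; ring) ?_
  · rw [hb2, ← mmseZ_eq] at h
    refine le_trans ?_ h
    have h1 : (gaussianReal 0 1).real K ≤ 1 := measureReal_le_one
    have h2 : (0 : ℝ) ≤ (gaussianReal 0 1).real K := measureReal_nonneg
    have h3 : (gaussianReal 0 1).real (flatSet f) - ε ≤
        truncMoment R * (gaussianReal 0 1).real K := by nlinarith
    nlinarith
  · intro y hy w hw
    refine lt_of_le_of_lt ?_ hv
    have h1 : |y| ≤ B := hB y hy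
    have h2 : |w| ≤ R := abs_le.2 hw
    have e : Real.sqrt (1 - v) * y - Real.sqrt v * w - y =
      -((1 - Real.sqrt (1 - v)) * y) - Real.sqrt v * w := by ring
    rw [e]
    refine (abs_sub _ _).trans ?_
    rw [abs_neg, abs_mul, abs_mul, abs_of_nonneg (sub_nonneg.2 ha1),
      abs_of_nonneg (Real.sqrt_nonneg v)]
    gcongr

theorem PiecewiseSmooth.measurable {f : ℝ → ℝ} (hf : PiecewiseSmooth f) : Measurable f := by
  obtain ⟨K, I, hI, -, hcover, hsm⟩ := hf
  refine measurable_of_isOpen fun t ht => ?_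
  have e : f ⁻¹' t = ⋃ i, (f ⁻¹' t ∩ I i) := by
    rw [← inter_iUnion, hcover, inter_univ]
  rw [e]
  refine MeasurableSet.iUnion fun i => ?_
  obtain ⟨u, hu, hue⟩ := continuousOn_iff'.1 (hsm i).1.continuousOn t ht
  rw [hue]
  exact hu.measurableSet.inter (hI i).measurableSet

/-! ### The map `φ` -/

theorem mmseZ_nonneg (f : ℝ → ℝ) (v : ℝ) : 0 ≤ mmseZ f v := gaussMMSE_nonneg _ _

theorem inv_sub_one_nonneg {v : ℝ} (hv : v ∈ Ioc (0 : ℝ) 1) : 0 ≤ v⁻¹ - 1 :=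
  sub_nonneg.2 ((one_le_inv₀ hv.1).2 hv.2)

/-- Start from `M(0) ≤ 1` and add strength `1/v - 1`. Consequently the truncated subtraction in
`phiPos` is a true one. -/
theorem mmseZ_le_self {f : ℝ → ℝ} (hf : Measurable f) {v : ℝ} (hv : v ∈ Ioc (0 : ℝ) 1) :
    mmseZ f v ≤ v := by
  have hs := inv_sub_one_nonneg hv
  have h := gaussMMSE_add_le hf le_rfl hs
  rw [zero_add, ← mmseZ_eq] at h
  have h1 := gaussMMSE_le_one hf 0
  have h0 := gaussMMSE_nonneg f 0
  have hv0 := hv.1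
  set m := gaussMMSE f 0
  have hpos : 0 < 1 + (v⁻¹ - 1) * m := by positivity
  refine le_of_mul_le_mul_right (h.trans ?_) hpos
  have : v * (1 + (v⁻¹ - 1) * m) = v + m - v * m := by
    field_simp; ring
  rw [this]
  nlinarith

theorem inv_ofReal_eq {v w : ℝ} (hv : 0 < v) (hvw : v ≤ w) :
    (ENNReal.ofReal v)⁻¹ = (ENNReal.ofReal w)⁻¹ + ENNReal.ofReal (v⁻¹ - w⁻¹) := by
  have hw := hv.trans_le hvw
  have h : 0 ≤ v⁻¹ - w⁻¹ := sub_nonneg.2 (inv_anti₀ hv hvw)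
  rw [← ENNReal.ofReal_inv_of_pos hv, ← ENNReal.ofReal_inv_of_pos hw,
    ← ENNReal.ofReal_add (by positivity) h]
  congr 1; ring

theorem phiPos_monotoneOn {f : ℝ → ℝ} (hf : Measurable f) :
    MonotoneOn (phiPos f) (Ioc (0 : ℝ) 1) := by
  intro v hv w hw hvw
  have hΔ : 0 ≤ v⁻¹ - w⁻¹ := sub_nonneg.2 (inv_anti₀ hv.1 hvw)
  have h := gaussMMSE_add_le hf (inv_sub_one_nonneg hw) hΔ
  rw [show w⁻¹ - 1 + (v⁻¹ - w⁻¹) = v⁻¹ - 1 by ring, ← mmseZ_eq, ← mmseZ_eq] at h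
  unfold phiPos
  rw [ENNReal.inv_le_inv, inv_ofReal_eq hv.1 hvw]
  have key : (ENNReal.ofReal (mmseZ f w))⁻¹ + ENNReal.ofReal (v⁻¹ - w⁻¹) ≤
      (ENNReal.ofReal (mmseZ f v))⁻¹ := by
    rcases (mmseZ_nonneg f v).eq_or_lt with h0 | h0
    · simp [← h0]
    have hw0 : 0 < mmseZ f w := by
      rcases (mmseZ_nonneg f w).eq_or_lt with hw0 | hw0
      · rw [← hw0] at h; simp at h; linarith
      · exact hw0
    rw [← ENNReal.ofReal_inv_of_pos h0, ← ENNReal.ofReal_inv_of_pos hw0,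
      ← ENNReal.ofReal_add (by positivity) hΔ]
    refine ENNReal.ofReal_le_ofReal ?_
    rw [← one_div (mmseZ f v), le_div_iff₀ h0]
    have : ((mmseZ f w)⁻¹ + (v⁻¹ - w⁻¹)) * mmseZ f v =
        (mmseZ f v * (1 + (v⁻¹ - w⁻¹) * mmseZ f w)) / mmseZ f w := by
      field_simp
    rw [this, div_le_one hw0]
    exact h
  calc (ENNReal.ofReal (mmseZ f w))⁻¹ - (ENNReal.ofReal w)⁻¹
      = ((ENNReal.ofReal (mmseZ f w))⁻¹ + ENNReal.ofReal (v⁻¹ - w⁻¹)) -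
        ((ENNReal.ofReal w)⁻¹ + ENNReal.ofReal (v⁻¹ - w⁻¹)) :=
        (ENNReal.add_sub_add_eq_sub_right ENNReal.ofReal_ne_top).symm
    _ ≤ _ := tsub_le_tsub_right key _

/-- Monotonicity supplies the one-sided limit, so the `limUnder` in `phi` is not a junk value. -/
theorem tendsto_phiPos_zero {f : ℝ → ℝ} (hf : Measurable f) :
    Tendsto (phiPos f) (𝓝[>] 0) (𝓝 (phi f 0)) := by
  have h := MonotoneOn.tendsto_nhdsWithin_Ioo_right (nonempty_Ioo.2 zero_lt_one)
    ((phiPos_monotoneOn hf).mono Ioo_subset_Ioc_self) (OrderBot.bddBelow _)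
  unfold phi
  rw [if_pos rfl, h.limUnder_eq]
  exact h

theorem phi_of_pos {f : ℝ → ℝ} {v : ℝ} (hv : 0 < v) : phi f v = phiPos f v := if_neg hv.ne'

theorem phi_monotoneOn {f : ℝ → ℝ} (hf : Measurable f) : MonotoneOn (phi f) (Icc (0 : ℝ) 1) := by
  intro v hv w hw hvw
  rcases hv.1.eq_or_lt with rfl | hv0
  · rcases hw.1.eq_or_lt with rfl | hw0
    · exact le_rfl
    refine le_of_tendsto (tendsto_phiPos_zero hf) ?_
    filter_upwards [Ioo_mem_nhdsGT hw0] with u hu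
    rw [phi_of_pos hw0]
    exact phiPos_monotoneOn hf ⟨hu.1, hu.2.le.trans hw.2⟩ ⟨hw0, hw.2⟩ hu.2.le
  · have hw0 := hv0.trans_le hvw
    rw [phi_of_pos hv0, phi_of_pos hw0]
    exact phiPos_monotoneOn hf ⟨hv0, hv.2⟩ ⟨hw0, hw.2⟩ hvw

theorem mmseZ_monotoneOn {f : ℝ → ℝ} (hf : Measurable f) :
    MonotoneOn (mmseZ f) (Ioc (0 : ℝ) 1) := fun _ hv _ hw hvw =>
  gaussMMSE_antitone hf (inv_sub_one_nonneg hw) (sub_le_sub_right (inv_anti₀ hv.1 hvw) 1)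

/-- Monotonicity bounds nearby values from below, upper semicontinuity from above. Right-continuity
suffices because the iteration decreases. -/
theorem continuousWithinAt_mmseZ {f : ℝ → ℝ} (hf : Measurable f) {v : ℝ}
    (hv : v ∈ Ioc (0 : ℝ) 1) : ContinuousWithinAt (mmseZ f) (Icc v 1) v := by
  have hinv : Tendsto (fun w : ℝ => w⁻¹ - 1) (𝓝 v) (𝓝 (v⁻¹ - 1)) :=
    (tendsto_inv₀ hv.1.ne').sub_const 1
  refine tendsto_order.2 ⟨fun l hl => ?_, fun u hu => ?_⟩
  · filter_upwards [self_mem_nhdsWithin] with w hw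
    exact hl.trans_le (mmseZ_monotoneOn hf hv ⟨hv.1.trans_le hw.1, hw.2⟩ hw.1)
  · have h := hinv.eventually (eventually_gaussMMSE_lt hf (v⁻¹ - 1) (sub_pos.2 hu))
    filter_upwards [nhdsWithin_le_nhds h] with w hw
    rw [← mmseZ_eq, ← mmseZ_eq] at hw
    linarith

theorem continuousWithinAt_phi {f : ℝ → ℝ} (hf : Measurable f) {v : ℝ}
    (hv : v ∈ Icc (0 : ℝ) 1) : ContinuousWithinAt (phi f) (Icc v 1) v := by
  rcases hv.1.eq_or_lt with rfl | hv0
  · rw [← continuousWithinAt_sdiff_self]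
    refine ((tendsto_phiPos_zero hf).mono_left
      (nhdsWithin_mono _ fun w hw => ?_)).congr' ?_
    · exact lt_of_le_of_ne hw.1.1 (Ne.symm hw.2)
    · filter_upwards [self_mem_nhdsWithin] with w hw
      rw [phi_of_pos (lt_of_le_of_ne hw.1.1 (Ne.symm hw.2))]
  · have h : ContinuousWithinAt (phiPos f) (Icc v 1) v := by
      have h1 := (ENNReal.continuous_ofReal.tendsto _).comp
        (continuousWithinAt_mmseZ hf ⟨hv0, hv.2⟩)
      have h2 : Tendsto (fun w : ℝ => (ENNReal.ofReal w)⁻¹) (𝓝[Icc v 1] v)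
          (𝓝 (ENNReal.ofReal v)⁻¹) :=
        ((continuous_inv.comp ENNReal.continuous_ofReal).tendsto v).mono_left nhdsWithin_le_nhds
      have h3 := ENNReal.Tendsto.sub (h1.inv) h2 (Or.inr (by simpa using hv0))
      exact h3.inv
    refine h.congr (fun w hw => phi_of_pos (hv0.trans_le hw.1)) (phi_of_pos hv0)

theorem phiPos_eq_zero_iff {f : ℝ → ℝ} {v : ℝ} (hv : 0 < v) :
    phiPos f v = 0 ↔ mmseZ f v = 0 := by
  unfold phiPos
  rw [ENNReal.inv_eq_zero, ENNReal.sub_eq_top_iff]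
  simp only [ENNReal.inv_eq_top, ne_eq, ENNReal.ofReal_eq_zero, not_le]
  exact ⟨fun h => le_antisymm h.1 (mmseZ_nonneg f v), fun h => ⟨h.le, hv⟩⟩

theorem toReal_inv_phiPos {f : ℝ → ℝ} (hf : Measurable f) {v : ℝ} (hv : v ∈ Ioc (0 : ℝ) 1)
    (hm : 0 < mmseZ f v) : ((phiPos f v)⁻¹).toReal = (mmseZ f v)⁻¹ - v⁻¹ := by
  unfold phiPos
  rw [inv_inv, ENNReal.toReal_sub_of_le, ENNReal.toReal_inv, ENNReal.toReal_inv,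
    ENNReal.toReal_ofReal hm.le, ENNReal.toReal_ofReal hv.1.le]
  · exact ENNReal.inv_le_inv.2 (ENNReal.ofReal_le_ofReal (mmseZ_le_self hf hv))
  · simpa using hm

/-! ### The maps `MSE_λ` and `Φ` -/

/-- The standing assumptions on the law of `λ`. -/
structure AdmissibleLaw (Pl : Measure ℝ) (a b δ : ℝ) : Prop where
  prob : IsProbabilityMeasure Pl
  pos : 0 < a
  supp : ∀ᵐ l ∂Pl, l ∈ Icc a b
  one_lt : 1 < δ
  mean : ∫ l, l ∂Pl = δ

theorem ratio_eq {V : ℝ≥0∞} (hV : V ≠ 0) {l : ℝ} (hl : 0 < l) :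
    ratio V l = 1 / (1 + (V⁻¹).toReal * l) := by
  unfold ratio
  split_ifs with h
  · simp [h]
  · have hpos : 0 < V.toReal := ENNReal.toReal_pos hV h
    rw [ENNReal.toReal_inv]
    field_simp

theorem ratio_nonneg (V : ℝ≥0∞) {l : ℝ} (hl : 0 < l) : 0 ≤ ratio V l := by
  unfold ratio
  split_ifs <;> positivity

theorem ratio_le_one (V : ℝ≥0∞) {l : ℝ} (hl : 0 < l) : ratio V l ≤ 1 := by
  unfold ratio
  split_ifs
  · exact le_rfl
  · rw [div_le_one (by positivity)]; linarith

theorem harm_eq (V : ℝ≥0∞) (l : ℝ) : harm V l = l * ratio V l := by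
  unfold harm ratio
  split_ifs <;> ring

/-- In the form `(1 + l V⁻¹)⁻¹` over `[0, ∞]` the endpoints `0` and `∞` need no separate limit
argument. -/
theorem continuous_ratio {l : ℝ} (hl : 0 < l) : Continuous fun V => ratio V l := by
  have e : (fun V => ratio V l) = fun V : ℝ≥0∞ => ((1 + ENNReal.ofReal l * V⁻¹)⁻¹).toReal := by
    ext V
    unfold ratio
    split_ifs with h
    · simp [h]
    · rcases eq_or_ne V 0 with rfl | hV
      · have : ENNReal.ofReal l * ⊤ = ⊤ := ENNReal.mul_top (by simpa using hl)
        simp [this]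
      have hpos : 0 < V.toReal := ENNReal.toReal_pos hV h
      rw [ENNReal.toReal_inv, ENNReal.toReal_add ENNReal.one_ne_top
        (ENNReal.mul_ne_top ENNReal.ofReal_ne_top (ENNReal.inv_ne_top.2 hV)), ENNReal.toReal_mul,
        ENNReal.toReal_inv, ENNReal.toReal_ofReal hl.le, ENNReal.toReal_one]
      field_simp
  rw [e, continuous_iff_continuousAt]
  intro V
  refine ContinuousAt.comp (g := ENNReal.toReal) (ENNReal.continuousAt_toReal ?_) ?_
  · exact ENNReal.inv_ne_top.2 (by simp)
  · refine Continuous.continuousAt ?_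
    have := ENNReal.continuous_const_mul (a := ENNReal.ofReal l) ENNReal.ofReal_ne_top
    exact (continuous_const.add (this.comp continuous_inv)).inv

theorem measurable_ratio (V : ℝ≥0∞) : Measurable (ratio V) := by
  unfold ratio
  split_ifs <;> fun_prop

theorem AdmissibleLaw.ae_pos {Pl : Measure ℝ} {a b δ : ℝ} (h : AdmissibleLaw Pl a b δ) :
    ∀ᵐ l ∂Pl, 0 < l := h.supp.mono fun _ hl => h.pos.trans_le hl.1

theorem AdmissibleLaw.integrable_ratio {Pl : Measure ℝ} {a b δ : ℝ} (h : AdmissibleLaw Pl a b δ)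
    (V : ℝ≥0∞) : Integrable (ratio V) Pl := by
  have := h.prob
  refine Integrable.of_bound (measurable_ratio V).aestronglyMeasurable 1 ?_
  filter_upwards [h.ae_pos] with l hl
  rw [Real.norm_of_nonneg (ratio_nonneg V hl)]
  exact ratio_le_one V hl

theorem AdmissibleLaw.integrable_harm {Pl : Measure ℝ} {a b δ : ℝ} (h : AdmissibleLaw Pl a b δ)
    (V : ℝ≥0∞) : Integrable (harm V) Pl := by
  have := h.prob
  have e : harm V = fun l => l * ratio V l := funext fun l => harm_eq V l
  rw [e]
  refine Integrable.of_bound (measurable_id.mul (measurable_ratio V)).aestronglyMeasurable b ?_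
  filter_upwards [h.ae_pos, h.supp] with l hl hl2
  rw [Real.norm_of_nonneg (mul_nonneg hl.le (ratio_nonneg V hl))]
  nlinarith [ratio_le_one V hl, hl2.2]

theorem AdmissibleLaw.continuous_mse {Pl : Measure ℝ} {a b δ : ℝ} (h : AdmissibleLaw Pl a b δ) :
    Continuous (mse Pl) := by
  have := h.prob
  refine continuous_iff_seqContinuous.2 fun u V hu => ?_
  refine tendsto_integral_of_dominated_convergence (fun _ => 1)
    (fun n => (measurable_ratio _).aestronglyMeasurable) (integrable_const _) (fun n => ?_) ?_
  · filter_upwards [h.ae_pos] with l hl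
    rw [Real.norm_of_nonneg (ratio_nonneg _ hl)]
    exact ratio_le_one _ hl
  · filter_upwards [h.ae_pos] with l hl
    exact ((continuous_ratio hl).tendsto V).comp hu

/-- `(1/δ) E[V λ / (V + λ)]`. -/
noncomputable def harmMean (Pl : Measure ℝ) (δ : ℝ) (V : ℝ≥0∞) : ℝ := 1 / δ * ∫ l, harm V l ∂Pl

theorem AdmissibleLaw.continuous_harmMean {Pl : Measure ℝ} {a b δ : ℝ}
    (h : AdmissibleLaw Pl a b δ) : Continuous (harmMean Pl δ) := by
  have := h.prob
  refine Continuous.mul continuous_const ?_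
  refine continuous_iff_seqContinuous.2 fun u V hu => ?_
  refine tendsto_integral_of_dominated_convergence (fun _ => b)
    (fun n => (h.integrable_harm _).aestronglyMeasurable) (integrable_const _) (fun n => ?_) ?_
  · filter_upwards [h.ae_pos, h.supp] with l hl hl2
    rw [harm_eq, Real.norm_of_nonneg (mul_nonneg hl.le (ratio_nonneg _ hl))]
    nlinarith [ratio_le_one (u n) hl, hl2.2]
  · filter_upwards [h.ae_pos] with l hl
    simp only [harm_eq]
    exact (((continuous_ratio hl).tendsto V).comp hu).const_mul l

theorem AdmissibleLaw.pos_delta {Pl : Measure ℝ} {a b δ : ℝ} (h : AdmissibleLaw Pl a b δ) : 0 < δ :=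
  zero_lt_one.trans h.one_lt

theorem AdmissibleLaw.mse_nonneg {Pl : Measure ℝ} {a b δ : ℝ} (h : AdmissibleLaw Pl a b δ)
    (V : ℝ≥0∞) : 0 ≤ mse Pl V :=
  integral_nonneg_of_ae (h.ae_pos.mono fun _ hl => ratio_nonneg V hl)

theorem mse_zero (Pl : Measure ℝ) : mse Pl 0 = 0 := by simp [mse, ratio]

theorem AdmissibleLaw.mse_pos {Pl : Measure ℝ} {a b δ : ℝ} (h : AdmissibleLaw Pl a b δ)
    {V : ℝ≥0∞} (hV : V ≠ 0) : 0 < mse Pl V := by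
  have := h.prob
  have hc : ∀ᵐ l ∂Pl, 1 / (1 + (V⁻¹).toReal * b) ≤ ratio V l := by
    filter_upwards [h.ae_pos, h.supp] with l hl hl2
    rw [ratio_eq hV hl]
    have : (0 : ℝ) ≤ (V⁻¹).toReal := ENNReal.toReal_nonneg
    have := hl2.2
    gcongr
  have hb : 0 < b := by
    obtain ⟨l, hl⟩ := h.supp.exists
    exact h.pos.trans_le (hl.1.trans hl.2)
  have h2 := integral_mono_ae (integrable_const _) (h.integrable_ratio V) hc
  have h3 : 0 < 1 / (1 + (V⁻¹).toReal * b) := by positivity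
  simp only [integral_const, probReal_univ, one_smul] at h2
  exact h3.trans_le h2

theorem AdmissibleLaw.harmMean_pos {Pl : Measure ℝ} {a b δ : ℝ} (h : AdmissibleLaw Pl a b δ)
    {V : ℝ≥0∞} (hV : V ≠ 0) : 0 < harmMean Pl δ V := by
  have hδ := h.pos_delta
  have h2 : a * mse Pl V ≤ ∫ l, harm V l ∂Pl := by
    rw [mse, ← integral_const_mul]
    refine integral_mono_ae ((h.integrable_ratio V).const_mul a) (h.integrable_harm V) ?_
    filter_upwards [h.ae_pos, h.supp] with l hl hl2
    rw [harm_eq]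
    exact mul_le_mul_of_nonneg_right hl2.1 (ratio_nonneg V hl)
  have h3 := mul_pos h.pos (h.mse_pos hV)
  exact mul_pos (by positivity) (h3.trans_le h2)

/-- Integrate `V/(V + l) + l/(V + l) = 1`. -/
theorem AdmissibleLaw.mse_eq {Pl : Measure ℝ} {a b δ : ℝ} (h : AdmissibleLaw Pl a b δ)
    {V : ℝ≥0∞} (hV : V ≠ 0) : mse Pl V = 1 - δ * ((V⁻¹).toReal * harmMean Pl δ V) := by
  have := h.prob
  have hδ := h.pos_delta
  have e : ∫ l, (ratio V l + (V⁻¹).toReal * harm V l) ∂Pl = ∫ _l, (1 : ℝ) ∂Pl := by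
    refine integral_congr_ae ?_
    filter_upwards [h.ae_pos] with l hl
    have : (0 : ℝ) ≤ (V⁻¹).toReal := ENNReal.toReal_nonneg
    rw [harm_eq, ratio_eq hV hl]
    field_simp
  rw [integral_add (h.integrable_ratio V) ((h.integrable_harm V).const_mul _),
    integral_const_mul] at e
  simp only [integral_const, probReal_univ, one_smul] at e
  rw [harmMean, mse]
  field_simp
  linarith

theorem AdmissibleLaw.harmMean_top {Pl : Measure ℝ} {a b δ : ℝ} (h : AdmissibleLaw Pl a b δ) :
    harmMean Pl δ ⊤ = 1 := by
  have : ∫ l, harm ⊤ l ∂Pl = δ := by simpa [harm] using h.mean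
  rw [harmMean, this, one_div, inv_mul_cancel₀ h.pos_delta.ne']

/-- With `t = 1/W`, `harm W l = l/(1 + t l)` is the MMSE of a Gaussian of variance `l` at strength
`t`, so the argument of `gaussMMSE_add_le` applies pointwise with one common `c`. The factor `1/δ`
only shrinks the term `c²Δ`, as `δ > 1`. -/
theorem AdmissibleLaw.inv_harmMean_add_le {Pl : Measure ℝ} {a b δ : ℝ}
    (h : AdmissibleLaw Pl a b δ) {V W : ℝ≥0∞} (hV : V ≠ 0) (hVW : V ≤ W) :
    (harmMean Pl δ W)⁻¹ - (W⁻¹).toReal ≤ (harmMean Pl δ V)⁻¹ - (V⁻¹).toReal := by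
  have hW : W ≠ 0 := (pos_iff_ne_zero.2 hV |>.trans_le hVW).ne'
  have hδ := h.pos_delta
  set s := (V⁻¹).toReal with hs
  set t := (W⁻¹).toReal with ht
  have hts : t ≤ s := ENNReal.toReal_mono (ENNReal.inv_ne_top.2 hV) (ENNReal.inv_le_inv.2 hVW)
  have ht0 : 0 ≤ t := ENNReal.toReal_nonneg
  have hpW := h.harmMean_pos hW
  have hpV := h.harmMean_pos hV
  set Δ := s - t with hΔ
  have hΔ0 : 0 ≤ Δ := sub_nonneg.2 hts
  set m := harmMean Pl δ W with hm
  set c := m / (1 + Δ * m) with hc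
  have hpos : 0 < 1 + Δ * m := by positivity
  have := h.prob
  have key : ∫ l, harm V l ∂Pl ≤ ∫ l, ((1 - c * Δ) ^ 2 * harm W l + c ^ 2 * Δ) ∂Pl := by
    refine integral_mono_ae (h.integrable_harm V)
      (((h.integrable_harm W).const_mul _).add (integrable_const _)) ?_
    filter_upwards [h.ae_pos] with l hl
    simp only [harm_eq]
    rw [ratio_eq hV hl, ratio_eq hW hl, ← hs, ← ht]
    have hs0 : 0 ≤ s := ht0.trans hts
    have hst : s = t + Δ := by rw [hΔ]; ring
    rw [hst]
    have hp1 : 0 < 1 + t * l := by positivity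
    have hp2 : 0 < 1 + (t + Δ) * l := by positivity
    have e : (1 - c * Δ) ^ 2 * (l * (1 / (1 + t * l))) + c ^ 2 * Δ - l * (1 / (1 + (t + Δ) * l))
        = Δ * (c * (1 + (t + Δ) * l) - l) ^ 2 / ((1 + t * l) * (1 + (t + Δ) * l)) := by
      field_simp; ring
    have : 0 ≤ Δ * (c * (1 + (t + Δ) * l) - l) ^ 2 / ((1 + t * l) * (1 + (t + Δ) * l)) := by
      positivity
    linarith
  rw [integral_add ((h.integrable_harm W).const_mul _) (integrable_const _),
    integral_const_mul] at key
  simp only [integral_const, probReal_univ, one_smul] at key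
  have h1 : harmMean Pl δ V ≤ (1 - c * Δ) ^ 2 * m + c ^ 2 * Δ := by
    have h2 : harmMean Pl δ V ≤ 1 / δ * ((1 - c * Δ) ^ 2 * (∫ l, harm W l ∂Pl) + c ^ 2 * Δ) :=
      mul_le_mul_of_nonneg_left key (by positivity)
    have h3 : 1 / δ * ((1 - c * Δ) ^ 2 * (∫ l, harm W l ∂Pl) + c ^ 2 * Δ) =
        (1 - c * Δ) ^ 2 * m + 1 / δ * (c ^ 2 * Δ) := by rw [hm, harmMean]; ring
    have h4 : 1 / δ * (c ^ 2 * Δ) ≤ 1 * (c ^ 2 * Δ) := by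
      refine mul_le_mul_of_nonneg_right ?_ (by positivity)
      rw [div_le_one hδ]; exact h.one_lt.le
    linarith
  have h5 : (1 - c * Δ) ^ 2 * m + c ^ 2 * Δ = m / (1 + Δ * m) := by
    rw [hc]; field_simp; ring
  rw [h5] at h1
  have h6 := inv_anti₀ hpV h1
  have h7 : (m / (1 + Δ * m))⁻¹ = m⁻¹ + Δ := by field_simp
  rw [h7] at h6
  linarith

theorem Phi_zero (Pl : Measure ℝ) (δ : ℝ) : Phi Pl δ 0 = 0 := if_pos rfl

theorem Phi_of_ne_zero (Pl : Measure ℝ) (δ : ℝ) {V : ℝ≥0∞} (hV : V ≠ 0) :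
    Phi Pl δ V = ((harmMean Pl δ V)⁻¹ - (V⁻¹).toReal)⁻¹ := by
  rw [Phi, if_neg hV, harmMean, one_div (1 / δ * _)]

theorem AdmissibleLaw.one_le_inv_Phi {Pl : Measure ℝ} {a b δ : ℝ} (h : AdmissibleLaw Pl a b δ)
    {V : ℝ≥0∞} (hV : V ≠ 0) : 1 ≤ (harmMean Pl δ V)⁻¹ - (V⁻¹).toReal := by
  have := h.inv_harmMean_add_le hV le_top
  rw [h.harmMean_top] at this
  simpa using this

theorem AdmissibleLaw.Phi_pos {Pl : Measure ℝ} {a b δ : ℝ} (h : AdmissibleLaw Pl a b δ)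
    {V : ℝ≥0∞} (hV : V ≠ 0) : 0 < Phi Pl δ V := by
  rw [Phi_of_ne_zero _ _ hV]
  exact inv_pos.2 (zero_lt_one.trans_le (h.one_le_inv_Phi hV))

theorem AdmissibleLaw.Phi_nonneg {Pl : Measure ℝ} {a b δ : ℝ} (h : AdmissibleLaw Pl a b δ)
    (V : ℝ≥0∞) : 0 ≤ Phi Pl δ V := by
  rcases eq_or_ne V 0 with rfl | hV
  · rw [Phi_zero]
  · exact (h.Phi_pos hV).le

theorem AdmissibleLaw.Phi_le_one {Pl : Measure ℝ} {a b δ : ℝ} (h : AdmissibleLaw Pl a b δ)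
    (V : ℝ≥0∞) : Phi Pl δ V ≤ 1 := by
  rcases eq_or_ne V 0 with rfl | hV
  · rw [Phi_zero]; exact zero_le_one
  · rw [Phi_of_ne_zero _ _ hV]
    exact inv_le_one_of_one_le₀ (h.one_le_inv_Phi hV)

theorem AdmissibleLaw.Phi_monotone {Pl : Measure ℝ} {a b δ : ℝ} (h : AdmissibleLaw Pl a b δ) :
    Monotone (Phi Pl δ) := by
  intro V W hVW
  rcases eq_or_ne V 0 with rfl | hV
  · rw [Phi_zero]; exact h.Phi_nonneg W
  have hW : W ≠ 0 := (pos_iff_ne_zero.2 hV |>.trans_le hVW).ne'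
  rw [Phi_of_ne_zero _ _ hV, Phi_of_ne_zero _ _ hW]
  exact inv_anti₀ (zero_lt_one.trans_le (h.one_le_inv_Phi hW)) (h.inv_harmMean_add_le hV hVW)

/-- Nonnegativity of the MSE gives `1/harmMean ≥ δ/V`, hence `1/Φ(V) ≥ (δ - 1)/V`. This yields
continuity of `Φ` at `0`. -/
theorem AdmissibleLaw.Phi_le {Pl : Measure ℝ} {a b δ : ℝ} (h : AdmissibleLaw Pl a b δ)
    {V : ℝ≥0∞} (hV : V ≠ ⊤) : Phi Pl δ V ≤ V.toReal / (δ - 1) := by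
  rcases eq_or_ne V 0 with rfl | hV0
  · simp [Phi_zero]
  have h1 := h.mse_eq hV0
  have h2 := h.mse_nonneg V
  have hm := h.harmMean_pos hV0
  have hV' : 0 < V.toReal := ENNReal.toReal_pos hV0 hV
  have hδ := sub_pos.2 h.one_lt
  rw [Phi_of_ne_zero _ _ hV0, ENNReal.toReal_inv]
  rw [ENNReal.toReal_inv] at h1
  have h3 : δ * V.toReal⁻¹ ≤ (harmMean Pl δ V)⁻¹ := by
    rw [← one_div (harmMean Pl δ V), le_div_iff₀ hm]; linarith
  have h4 : (V.toReal / (δ - 1))⁻¹ = (δ - 1) * V.toReal⁻¹ := by field_simp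
  rw [← inv_inv (V.toReal / (δ - 1)), h4]
  exact inv_anti₀ (by positivity) (by linarith)

theorem AdmissibleLaw.continuous_Phi {Pl : Measure ℝ} {a b δ : ℝ} (h : AdmissibleLaw Pl a b δ) :
    Continuous (Phi Pl δ) := by
  rw [continuous_iff_continuousAt]
  intro V
  rcases eq_or_ne V 0 with rfl | hV
  · rw [ContinuousAt, Phi_zero]
    have hlim : Tendsto (fun W : ℝ≥0∞ => W.toReal / (δ - 1)) (𝓝 0) (𝓝 0) := by
      simpa using (ENNReal.tendsto_toReal ENNReal.zero_ne_top).div_const (δ - 1)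
    refine tendsto_of_tendsto_of_tendsto_of_le_of_le' tendsto_const_nhds hlim
      (Eventually.of_forall fun W => h.Phi_nonneg W) ?_
    filter_upwards [gt_mem_nhds ENNReal.zero_lt_top] with W hW
    exact h.Phi_le hW.ne
  · have h1 : ContinuousAt (fun W : ℝ≥0∞ => ((harmMean Pl δ W)⁻¹ - (W⁻¹).toReal)⁻¹) V := by
      refine ContinuousAt.inv₀ (ContinuousAt.sub ?_ ?_) ?_
      · exact h.continuous_harmMean.continuousAt.inv₀ (h.harmMean_pos hV).ne'
      · exact ContinuousAt.comp (g := ENNReal.toReal)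
          (ENNReal.continuousAt_toReal (ENNReal.inv_ne_top.2 hV)) continuous_inv.continuousAt
      · exact (zero_lt_one.trans_le (h.one_le_inv_Phi hV)).ne'
    refine h1.congr ?_
    filter_upwards [isOpen_ne.mem_nhds hV] with W hW
    exact (Phi_of_ne_zero _ _ hW).symm

/-- With `s = 1/φ(v)` and `m` the harmonic mean at `φ(v)`, `P(v)` is a nonnegative multiple of `m⁻¹
- s - v⁻¹ = 1/Φ(φ(v)) - 1/v`. If `mmse_z(v) = 0`, both sides hold. -/
theorem AdmissibleLaw.PFun_pos_iff {Pl : Measure ℝ} {a b δ : ℝ} (h : AdmissibleLaw Pl a b δ)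
    {f : ℝ → ℝ} (hf : Measurable f) {v : ℝ} (hv : v ∈ Ioc (0 : ℝ) 1) :
    0 < PFun f Pl δ v ↔ Phi Pl δ (phi f v) < v := by
  have hδ := h.pos_delta
  have hv0 := hv.1
  rw [phi_of_pos hv.1, PFun, phi_of_pos hv.1]
  rcases (mmseZ_nonneg f v).eq_or_lt with hm | hm
  · rw [(phiPos_eq_zero_iff hv.1).2 hm.symm, mse_zero, Phi_zero, ← hm]
    simp only [zero_div]
    constructor
    · intro; exact hv.1
    · intro; linarith [h.one_lt]
  have hV : phiPos f v ≠ 0 := fun h0 => hm.ne' ((phiPos_eq_zero_iff hv.1).1 h0)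
  have hs := toReal_inv_phiPos hf hv hm
  have hinv := h.one_le_inv_Phi hV
  have hh := h.harmMean_pos hV
  rw [h.mse_eq hV, Phi_of_ne_zero _ _ hV]
  set V := phiPos f v
  set s := (V⁻¹).toReal with hsdef
  have hs0 : 0 ≤ s := ENNReal.toReal_nonneg
  set m := harmMean Pl δ V with hmdef
  have hmm : mmseZ f v / v = 1 / (1 + s * v) := by
    have : (mmseZ f v)⁻¹ = s + v⁻¹ := by linarith
    rw [← inv_inv (mmseZ f v), this]
    field_simp; ring
  have e : 1 - δ * (s * m) - (1 - δ * (1 - mmseZ f v / v)) =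
      δ * (s * m) * (v / (1 + s * v)) * (m⁻¹ - s - v⁻¹) := by
    rw [hmm]; field_simp; ring
  rw [e]
  have hT : 0 < m⁻¹ - s := zero_lt_one.trans_le hinv
  rw [inv_lt_comm₀ hT hv.1]
  constructor
  · intro hp
    by_contra hn
    push Not at hn
    have : 0 ≤ δ * (s * m) * (v / (1 + s * v)) := by positivity
    nlinarith
  · intro hlt
    -- `s = 0` would mean `φ(v) = ∞`, where `Φ = 1 ≥ v`.
    have hspos : 0 < s := by
      rcases hs0.eq_or_lt with h0 | h0
      · exfalso
        have hVtop : V = ⊤ := by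
          rcases (ENNReal.toReal_eq_zero_iff _).1 h0.symm with h1 | h1
          · exact ENNReal.inv_eq_zero.1 h1
          · exact absurd (ENNReal.inv_eq_top.1 h1) hV
        rw [hmdef, hVtop, h.harmMean_top, ← h0, inv_one, sub_zero] at hlt
        exact absurd ((one_le_inv₀ hv.1).2 hv.2) (not_le.2 hlt)
      · exact h0
    have : 0 < m⁻¹ - s - v⁻¹ := sub_pos.2 hlt
    positivity

/-! ### State evolution -/

/-- A monotone right-continuous self-map of `[0, 1]`, iterated from `1`, converges to its largest
fixed point. -/
theorem tendsto_iterate_of_monotoneOn {T : ℝ → ℝ} (hmaps : ∀ v ∈ Icc (0 : ℝ) 1, T v ∈ Icc (0 : ℝ) 1)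
    (hmono : MonotoneOn T (Icc 0 1))
    (hcont : ∀ v ∈ Icc (0 : ℝ) 1, ContinuousWithinAt T (Icc v 1) v) {vs : ℝ}
    (hvs : vs ∈ Icc (0 : ℝ) 1) (hfix : vs ≤ T vs) (hlt : ∀ u ∈ Ioc vs 1, T u < u)
    {x : ℕ → ℝ} (hx0 : x 0 = T 1) (hx : ∀ t, x (t + 1) = T (x t)) :
    (∀ t, x t ∈ Icc vs 1) ∧ Tendsto x atTop (𝓝 vs) := by
  have h1 : (1 : ℝ) ∈ Icc (0 : ℝ) 1 := ⟨zero_le_one, le_rfl⟩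
  have hmem : ∀ t, x t ∈ Icc vs 1 := by
    intro t
    induction t with
    | zero => rw [hx0]; exact ⟨hfix.trans (hmono hvs h1 hvs.2), (hmaps 1 h1).2⟩
    | succ t ih =>
      have hxt : x t ∈ Icc (0 : ℝ) 1 := ⟨hvs.1.trans ih.1, ih.2⟩
      rw [hx]
      exact ⟨hfix.trans (hmono hvs hxt ih.1), (hmaps _ hxt).2⟩
  have hmem' : ∀ t, x t ∈ Icc (0 : ℝ) 1 := fun t => ⟨hvs.1.trans (hmem t).1, (hmem t).2⟩
  have hanti : Antitone x := by
    refine antitone_nat_of_succ_le fun t => ?_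
    induction t with
    | zero => rw [hx, hx0]; exact hmono (hmaps 1 h1) h1 (hmaps 1 h1).2
    | succ t ih => rw [hx (t + 1), hx t]; exact hmono (by rw [← hx]; exact hmem' _) (hmem' t)
                    (by rw [← hx]; exact ih)
  have hbdd : BddBelow (range x) := ⟨vs, by rintro _ ⟨t, rfl⟩; exact (hmem t).1⟩
  have hlim := tendsto_atTop_ciInf hanti hbdd
  set L := ⨅ t, x t
  have hL1 : ∀ t, L ≤ x t := fun t => ciInf_le hbdd t
  have hLvs : vs ≤ L := le_ciInf fun t => (hmem t).1
  have hL : L ∈ Icc (0 : ℝ) 1 := ⟨hvs.1.trans hLvs, (hL1 0).trans (hmem 0).2⟩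
  -- The sequence approaches `L` from above, so right-continuity at `L` is enough.
  have hTL : Tendsto (fun t => x (t + 1)) atTop (𝓝 (T L)) := by
    simp only [hx]
    exact (hcont L hL).tendsto.comp (tendsto_nhdsWithin_iff.2
      ⟨hlim, Eventually.of_forall fun t => ⟨hL1 t, (hmem t).2⟩⟩)
  have hEq : L = T L := tendsto_nhds_unique ((tendsto_add_atTop_iff_nat 1).2 hlim) hTL
  have : L = vs := by
    by_contra hne
    exact (hlt L ⟨lt_of_le_of_ne hLvs (Ne.symm hne), hL.2⟩).ne hEq.symm
  exact ⟨hmem, this ▸ hlim⟩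

section Evolution

variable {f : ℝ → ℝ} {Pl : Measure ℝ} {a b δ : ℝ}

/-- Division by zero gives `0`, so the formula reads `mse - 1 + δ`; the point `0` never obstructs
`goodSet`. -/
theorem AdmissibleLaw.PFun_zero_pos (h : AdmissibleLaw Pl a b δ) : 0 < PFun f Pl δ 0 := by
  have h1 := h.mse_nonneg (phi f 0)
  have h2 := h.one_lt
  simp only [PFun, div_zero]
  linarith

theorem mem_goodSet_iff (h : AdmissibleLaw Pl a b δ) (hf : Measurable f) {v : ℝ} :
    v ∈ goodSet f Pl δ ↔ v ∈ Icc (0 : ℝ) 1 ∧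
      ∀ u ∈ Icc v 1, 0 < u → Phi Pl δ (phi f u) < u := by
  refine and_congr_right fun hv => forall₂_congr fun u hu => ?_
  constructor
  · intro hp hu0
    exact (h.PFun_pos_iff hf ⟨hu0, hu.2⟩).1 hp
  · intro hp
    rcases (hv.1.trans hu.1).eq_or_lt with rfl | hu0
    · exact h.PFun_zero_pos
    · exact (h.PFun_pos_iff hf ⟨hu0, hu.2⟩).2 (hp hu0)

theorem VrStar_mem (f : ℝ → ℝ) (Pl : Measure ℝ) (δ : ℝ) : VrStar f Pl δ ∈ Icc (0 : ℝ) 1 := by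
  unfold VrStar
  split_ifs with hne
  · obtain ⟨v, hv⟩ := hne
    exact ⟨Real.sInf_nonneg fun w hw => hw.1.1,
      (csInf_le ⟨0, fun w hw => hw.1.1⟩ hv).trans hv.1.2⟩
  · exact ⟨zero_le_one, le_rfl⟩

theorem Phi_phi_lt_of_VrStar_lt (h : AdmissibleLaw Pl a b δ) (hf : Measurable f) {u : ℝ}
    (hu : u ∈ Ioc (VrStar f Pl δ) 1) : Phi Pl δ (phi f u) < u := by
  have hu0 : 0 < u := (VrStar_mem f Pl δ).1.trans_lt hu.1
  unfold VrStar at hu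
  split_ifs at hu with hne
  · obtain ⟨g, hg, hgu⟩ := exists_lt_of_csInf_lt hne hu.1
    exact ((mem_goodSet_iff h hf).1 hg).2 u ⟨hgu.le, hu.2⟩ hu0
  · exact absurd hu.1 (not_lt.2 hu.2)

theorem Phi_phi_monotoneOn (h : AdmissibleLaw Pl a b δ) (hf : Measurable f) :
    MonotoneOn (fun v => Phi Pl δ (phi f v)) (Icc 0 1) := fun _ hv _ hw hvw =>
  h.Phi_monotone (phi_monotoneOn hf hv hw hvw)

/-- If `T(V_r^⋆) < w < V_r^⋆`, then `T(u) ≤ T(V_r^⋆) < w ≤ u` for `u ∈ [w, V_r^⋆]`, so `w` is in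
`goodSet`, below its infimum. -/
theorem VrStar_le_Phi_phi (h : AdmissibleLaw Pl a b δ) (hf : Measurable f) :
    VrStar f Pl δ ≤ Phi Pl δ (phi f (VrStar f Pl δ)) := by
  by_contra hlt
  push Not at hlt
  set vs := VrStar f Pl δ with hvs
  have hmem : vs ∈ Icc (0 : ℝ) 1 := VrStar_mem f Pl δ
  obtain ⟨w, hw1, hw2⟩ := exists_between hlt
  have hw0 : 0 ≤ w := (h.Phi_nonneg _).trans hw1.le
  have hwg : w ∈ goodSet f Pl δ := by
    rw [mem_goodSet_iff h hf]
    refine ⟨⟨hw0, hw2.le.trans hmem.2⟩, fun u hu hu0 => ?_⟩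
    rcases le_or_gt u vs with huv | huv
    · exact ((Phi_phi_monotoneOn h hf ⟨hu0.le, hu.2⟩ hmem huv).trans_lt hw1).trans_le hu.1
    · exact Phi_phi_lt_of_VrStar_lt h hf ⟨huv, hu.2⟩
  have : vs ≤ w := by
    rw [hvs, VrStar, if_pos ⟨w, hwg⟩]
    exact csInf_le ⟨0, fun w hw => hw.1.1⟩ hwg
  exact absurd hw2 (not_lt.2 this)

theorem tendsto_mse_finalMSE (h : AdmissibleLaw Pl a b δ) (hf : Measurable f) {Vl : ℕ → ℝ≥0∞}
    {Vr : ℕ → ℝ} (hSE : IsStateEvolution f Pl δ Vl Vr) :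
    Tendsto (fun t => mse Pl (Vl t)) atTop (𝓝 (finalMSE f Pl δ)) := by
  have hvs := VrStar_mem f Pl δ
  obtain ⟨hmem, hlim⟩ := tendsto_iterate_of_monotoneOn (T := fun v => Phi Pl δ (phi f v))
    (fun v _ => ⟨h.Phi_nonneg _, h.Phi_le_one _⟩) (Phi_phi_monotoneOn h hf)
    (fun v hv => h.continuous_Phi.continuousAt.comp_continuousWithinAt (continuousWithinAt_phi hf hv))
    hvs (VrStar_le_Phi_phi h hf) (fun u hu => Phi_phi_lt_of_VrStar_lt h hf hu) (x := Vr)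
    (by rw [hSE.right, hSE.left_zero]) (fun t => by rw [hSE.right, hSE.left_succ])
  rw [← tendsto_add_atTop_iff_nat 1]
  simp only [hSE.left_succ]
  refine (h.continuous_mse.tendsto _).comp ?_
  exact (continuousWithinAt_phi hf hvs).tendsto.comp (tendsto_nhdsWithin_iff.2
    ⟨hlim, Eventually.of_forall hmem⟩)

/-- Otherwise `x = T(0) > 0` satisfies `T(x) ≥ T(0) = x`, contradicting `T(x) < x`. -/
theorem phi_zero_of_PFun_pos (h : AdmissibleLaw Pl a b δ) (hf : Measurable f)
    (hP : ∀ v ∈ Ioc (0 : ℝ) 1, 0 < PFun f Pl δ v) : phi f 0 = 0 := by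
  by_contra hne
  have hpos := h.Phi_pos hne
  set x := Phi Pl δ (phi f 0) with hx
  have hx1 : x ≤ 1 := h.Phi_le_one _
  have h1 := (h.PFun_pos_iff hf ⟨hpos, hx1⟩).1 (hP x ⟨hpos, hx1⟩)
  have h2 : Phi Pl δ (phi f 0) ≤ Phi Pl δ (phi f x) :=
    Phi_phi_monotoneOn h hf ⟨le_rfl, zero_le_one⟩ ⟨hpos.le, hx1⟩ hpos.le
  exact absurd h1 (not_lt.2 h2)

theorem finalMSE_eq_zero_iff (h : AdmissibleLaw Pl a b δ) (hf : Measurable f) :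
    finalMSE f Pl δ = 0 ↔ ∀ v ∈ Ioc (0 : ℝ) 1, 0 < PFun f Pl δ v := by
  constructor
  · intro h0 v hv
    have hphi : phi f (VrStar f Pl δ) = 0 := by
      by_contra hne
      exact (h.mse_pos hne).ne' h0
    have h1 := VrStar_le_Phi_phi (f := f) h hf
    rw [hphi, Phi_zero] at h1
    exact (h.PFun_pos_iff hf hv).2 (Phi_phi_lt_of_VrStar_lt h hf ⟨h1.trans_lt hv.1, hv.2⟩)
  · intro hP
    have hg : (0 : ℝ) ∈ goodSet f Pl δ := by
      rw [mem_goodSet_iff h hf]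
      exact ⟨⟨le_rfl, zero_le_one⟩, fun u hu hu0 =>
        (h.PFun_pos_iff hf ⟨hu0, hu.2⟩).1 (hP u ⟨hu0, hu.2⟩)⟩
    have hvs : VrStar f Pl δ = 0 := by
      refine le_antisymm ?_ (VrStar_mem f Pl δ).1
      rw [VrStar, if_pos ⟨0, hg⟩]
      exact csInf_le ⟨0, fun w hw => hw.1.1⟩ hg
    rw [finalMSE, hvs, phi_zero_of_PFun_pos h hf hP, mse_zero]

/-- Perfect reconstruction forces `δ (1 - p) ≥ 1` where `p` is the probability of a flat section. -/
theorem one_le_delta_mul_of_PFun_pos (h : AdmissibleLaw Pl a b δ) (hf : Measurable f)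
    (hP : ∀ v ∈ Ioc (0 : ℝ) 1, 0 < PFun f Pl δ v) :
    1 ≤ δ * (1 - (gaussianReal 0 1).real (flatSet f)) := by
  have hδ := h.pos_delta
  refine le_of_forall_pos_le_add fun ε hε => ?_
  have hlim : Tendsto (fun v => mse Pl (phiPos f v)) (𝓝[>] 0) (𝓝 0) := by
    have h1 := tendsto_phiPos_zero hf
    rw [phi_zero_of_PFun_pos h hf hP] at h1
    have h2 := (h.continuous_mse.tendsto 0).comp h1
    rwa [mse_zero] at h2
  -- At such `v`, `P(v) > 0` reads `1 < mse + δ(1 - mmse_z(v)/v) ≤ ε/2 + δ(1 - p) + ε/2`.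
  obtain ⟨v, h1, h2, h3⟩ := ((hlim.eventually (gt_mem_nhds (half_pos hε))).and
    ((eventually_le_mmseZ hf (show 0 < ε / (2 * δ) by positivity)).and
      (Ioo_mem_nhdsGT (zero_lt_one (α := ℝ))))).exists
  have h4 := hP v ⟨h3.1, h3.2.le⟩
  rw [PFun, phi_of_pos h3.1] at h4
  rw [← le_div_iff₀ h3.1] at h2
  have h5 : δ * ((gaussianReal 0 1).real (flatSet f) - ε / (2 * δ)) ≤ δ * (mmseZ f v / v) := by
    gcongr
  have h6 : δ * (ε / (2 * δ)) = ε / 2 := by field_simp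
  nlinarith

end Evolution

/-! ### Information dimension of mixed laws -/

/-- The cell `[k / M, (k + 1) / M)` of the quantizer of precision `M`. -/
def cell (M : ℕ) (k : ℤ) : Set ℝ := {x | ⌊(M : ℝ) * x⌋ = k}

@[fun_prop]
theorem measurable_floor_mul (M : ℕ) : Measurable fun x : ℝ => ⌊(M : ℝ) * x⌋ :=
  Int.measurable_floor.comp (measurable_const_mul _)

theorem measurableSet_cell (M : ℕ) (k : ℤ) : MeasurableSet (cell M k) :=
  measurable_floor_mul M (measurableSet_singleton k)

theorem tsum_mul_measure_cell (μ : Measure ℝ) (M : ℕ) (h : ℤ → ℝ≥0∞) :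
    ∑' k, h k * μ (cell M k) = ∫⁻ x, h ⌊(M : ℝ) * x⌋ ∂μ := by
  rw [← lintegral_map (f := h) (measurable_of_countable h) (measurable_floor_mul M),
    lintegral_countable']
  refine tsum_congr fun k => ?_
  rw [Measure.map_apply (measurable_floor_mul M) (measurableSet_singleton k)]
  rfl

theorem volume_cell {M : ℕ} (hM : M ≠ 0) (k : ℤ) :
    volume (cell M k) = ENNReal.ofReal ((M : ℝ)⁻¹) := by
  have hM' : (0 : ℝ) < M := by positivity
  have e : cell M k = Ico ((k : ℝ) / M) ((k + 1) / M) := by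
    ext x
    rw [cell, mem_ofPred_eq, Int.floor_eq_iff, mem_Ico, div_le_iff₀ hM', lt_div_iff₀ hM', mul_comm]
  rw [e, Real.volume_Ico]
  congr 1; field_simp; ring

theorem floor_mul_ediv {M : ℕ} (hM : M ≠ 0) (x : ℝ) : ⌊(M : ℝ) * x⌋ / (M : ℤ) = ⌊x⌋ := by
  have hM' : (M : ℝ) ≠ 0 := by positivity
  rw [← Int.floor_div_natCast, mul_div_cancel_left₀ _ hM']

/-- Entropy of the law `μ` quantized at precision `1 / M`. -/
noncomputable def cellEntropy (μ : Measure ℝ) (M : ℕ) : ℝ≥0∞ :=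
  ∑' k, ENNReal.ofReal (Real.negMulLog (μ.real (cell M k)))

theorem shannonEntropy_map_quantize (μ : Measure ℝ) {M : ℕ} (hM : M ≠ 0) :
    shannonEntropy (μ.map (quantize M)) = cellEntropy μ M := by
  have hM' : (M : ℝ) ≠ 0 := by positivity
  have hq : Measurable (quantize M) := by
    unfold quantize
    exact (measurable_from_top.comp (measurable_floor_mul M) :
      Measurable fun x : ℝ => ((⌊(M : ℝ) * x⌋ : ℤ) : ℝ)).div_const _
  have hinj : Function.Injective fun k : ℤ => (k : ℝ) / M := fun j k h => by
    have : (j : ℝ) = k := by simpa [div_left_inj' hM'] using h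
    exact_mod_cast this
  rw [shannonEntropy, ← hinj.tsum_eq]
  · refine tsum_congr fun k => ?_
    rw [measureReal_def, Measure.map_apply hq (measurableSet_singleton _), measureReal_def]
    congr 4
    ext x
    simp only [quantize, cell, mem_preimage, mem_singleton_iff, mem_ofPred_eq, div_left_inj' hM',
      Int.cast_inj]
  · intro y hy
    by_contra hne
    refine hy ?_
    have : quantize M ⁻¹' {y} = ∅ := by
      ext x
      simp only [mem_preimage, mem_singleton_iff, mem_empty_iff_false, iff_false]
      intro hx
      exact hne ⟨_, hx⟩
    simp only [measureReal_def]
    rw [Measure.map_apply hq (measurableSet_singleton _), this]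
    simp

theorem shannonEntropy_map_floor {Ω : Type*} [MeasurableSpace Ω] (μ : Measure Ω) {f : Ω → ℝ}
    (hf : Measurable f) : shannonEntropy (μ.map fun z => ⌊f z⌋) = cellEntropy (μ.map f) 1 := by
  refine tsum_congr fun k => ?_
  have hfl : Measurable fun z => ⌊f z⌋ := Int.measurable_floor.comp hf
  rw [measureReal_def, measureReal_def, Measure.map_apply hfl (measurableSet_singleton _), Measure.map_apply hf (measurableSet_cell 1 k)]
  congr 4
  ext x
  simp [cell]

theorem negMulLog_add_le {x y : ℝ} (hx : 0 ≤ x) (hy : 0 ≤ y) :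
    Real.negMulLog (x + y) ≤ Real.negMulLog x + Real.negMulLog y := by
  rcases hx.eq_or_lt with rfl | hx
  · simp
  rcases hy.eq_or_lt with rfl | hy
  · simp
  have h1 := Real.log_le_log hx (le_add_of_nonneg_right hy.le)
  have h2 := Real.log_le_log hy (le_add_of_nonneg_left hx.le)
  simp only [Real.negMulLog]
  nlinarith

/-- Gibbs' inequality for one term. -/
theorem negMulLog_le_add {x r m : ℝ} (hx : 0 ≤ x) (hxr : x ≤ r) (hm : 0 < m) :
    Real.negMulLog x ≤ x * Real.log m + x * (-Real.log r) + r / m := by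
  rcases hx.eq_or_lt with rfl | hx
  · simp only [Real.negMulLog_zero, zero_mul, zero_add]; positivity
  have hr := hx.trans_le hxr
  have h := Real.log_le_sub_one_of_pos (show 0 < r / m / x by positivity)
  rw [Real.log_div (by positivity) hx.ne', Real.log_div hr.ne' hm.ne'] at h
  have h2 := mul_le_mul_of_nonneg_left h hx.le
  have h3 : x * (r / m / x - 1) = r / m - x := by field_simp
  rw [h3] at h2
  simp only [Real.negMulLog]
  nlinarith

/-- At most `S.card` cells carry mass, each contributing at most `1`. -/
theorem tsum_negMulLog_cell_le_of_finite (μ : Measure ℝ) [IsFiniteMeasure μ] (M : ℕ)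
    (S : Finset ℝ) (hS : μ (↑S)ᶜ = 0) :
    cellEntropy μ M ≤ S.card := by
  have hterm : ∀ k, ENNReal.ofReal (Real.negMulLog (μ.real (cell M k))) ≤
      ∑ x ∈ S, if ⌊(M : ℝ) * x⌋ = k then 1 else 0 := by
    intro k
    by_cases hk : ∃ x ∈ S, ⌊(M : ℝ) * x⌋ = k
    · obtain ⟨x, hxS, hx⟩ := hk
      have h1 : ENNReal.ofReal (Real.negMulLog (μ.real (cell M k))) ≤ 1 := by
        rw [← ENNReal.ofReal_one]
        refine ENNReal.ofReal_le_ofReal ?_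
        have := Real.negMulLog_le_one_sub_self (measureReal_nonneg (μ := μ) (s := cell M k))
        linarith [measureReal_nonneg (μ := μ) (s := cell M k)]
      refine h1.trans ?_
      have h2 := Finset.single_le_sum (f := fun x : ℝ => if ⌊(M : ℝ) * x⌋ = k then (1 : ℝ≥0∞) else 0)
        (fun _ _ => zero_le) hxS
      simpa [hx] using h2
    · push Not at hk
      have h0 : μ (cell M k) = 0 := by
        exact measure_mono_null (fun x hx hxS => hk x hxS hx) hS
      simp [measureReal_def, h0]
  calc cellEntropy μ M ≤ ∑' k, ∑ x ∈ S, (if ⌊(M : ℝ) * x⌋ = k then 1 else 0) :=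
        ENNReal.tsum_le_tsum hterm
    _ = ∑ x ∈ S, ∑' k, (if ⌊(M : ℝ) * x⌋ = k then 1 else 0) :=
        Summable.tsum_finsetSum fun _ _ => ENNReal.summable
    _ = S.card := by
        simp [tsum_ite_eq']

/-- Subadditivity splits off the discrete part. The rest is compared, by Gibbs, with the law that
spreads each `ν (cell 1 j)` evenly over its `M` subcells; this costs `log M` per unit of `νc`-mass
plus the entropy at precision `1`. -/
theorem cellEntropy_le {ν νd νc : Measure ℝ} [IsProbabilityMeasure ν] (hν : ν = νd + νc)
    {S : Finset ℝ} (hS : νd (↑S)ᶜ = 0) {M : ℕ} (hM : M ≠ 0) :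
    cellEntropy ν M ≤
      (S.card + cellEntropy ν 1 + 1) + ENNReal.ofReal (Real.log M) * νc univ := by
  have hM' : (0 : ℝ) < M := by positivity
  have hdν : νd ≤ ν := by rw [hν]; exact Measure.le_add_right le_rfl
  have hcν : νc ≤ ν := by rw [hν]; exact Measure.le_add_left le_rfl
  have : IsFiniteMeasure νd := isFiniteMeasure_of_le ν hdν
  have : IsFiniteMeasure νc := isFiniteMeasure_of_le ν hcν
  set r : ℤ → ℝ := fun j => ν.real (cell 1 j) with hr
  have hr0 : ∀ j, 0 ≤ r j := fun j => measureReal_nonneg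
  have hr1 : ∀ j, r j ≤ 1 := fun j => measureReal_le_one
  have hlog : ∀ j, 0 ≤ -Real.log (r j) := fun j =>
    neg_nonneg.2 (Real.log_nonpos (hr0 j) (hr1 j))
  have hsub : ∀ k, cell M k ⊆ cell 1 (k / M) := by
    intro k x hx
    have hx' : ⌊(M : ℝ) * x⌋ = k := hx
    simp only [cell, mem_ofPred_eq, Nat.cast_one, one_mul]
    rw [← hx', floor_mul_ediv hM]
  have hterm : ∀ k, ENNReal.ofReal (Real.negMulLog (ν.real (cell M k))) ≤
      ENNReal.ofReal (Real.negMulLog (νd.real (cell M k))) +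
      (ENNReal.ofReal (Real.log M) * νc (cell M k) +
        ENNReal.ofReal (-Real.log (r (k / M))) * νc (cell M k) +
        ENNReal.ofReal (r (k / M)) * volume (cell M k)) := by
    intro k
    have e : ν.real (cell M k) = νd.real (cell M k) + νc.real (cell M k) := by
      rw [hν, measureReal_add_apply]
    have hxr : νc.real (cell M k) ≤ r (k / M) :=
      (ENNReal.toReal_mono (measure_ne_top _ _) (hcν _)).trans (measureReal_mono (hsub k))
    have hx0 : 0 ≤ νc.real (cell M k) := measureReal_nonneg
    have hL : 0 ≤ Real.log M := Real.log_nonneg (by exact_mod_cast Nat.one_le_iff_ne_zero.2 hM)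
    rw [e]
    refine (ENNReal.ofReal_le_ofReal (negMulLog_add_le measureReal_nonneg hx0)).trans ?_
    refine ENNReal.ofReal_add_le.trans (add_le_add le_rfl ?_)
    refine (ENNReal.ofReal_le_ofReal (negMulLog_le_add hx0 hxr hM')).trans (le_of_eq ?_)
    have h0 := hlog (k / M)
    have h1 := hr0 (k / M)
    rw [ENNReal.ofReal_add (by positivity) (by positivity), ENNReal.ofReal_add (by positivity)
      (by positivity), volume_cell hM, div_eq_mul_inv, ENNReal.ofReal_mul hx0,
      ENNReal.ofReal_mul hx0, ENNReal.ofReal_mul h1, ofReal_measureReal]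
    ring
  have h1 : ∑' k, ENNReal.ofReal (Real.negMulLog (νd.real (cell M k))) ≤ S.card :=
    tsum_negMulLog_cell_le_of_finite νd M S hS
  have h2 : ∑' k, ENNReal.ofReal (Real.log M) * νc (cell M k) =
      ENNReal.ofReal (Real.log M) * νc univ := by
    rw [tsum_mul_measure_cell νc M fun _ => ENNReal.ofReal (Real.log M), lintegral_const]
  have h3 : ∑' k, ENNReal.ofReal (-Real.log (r (k / M))) * νc (cell M k) ≤ cellEntropy ν 1 := by
    rw [tsum_mul_measure_cell νc M fun k => ENNReal.ofReal (-Real.log (r (k / M)))]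
    calc ∫⁻ x, ENNReal.ofReal (-Real.log (r (⌊(M : ℝ) * x⌋ / M))) ∂νc
        ≤ ∫⁻ x, ENNReal.ofReal (-Real.log (r (⌊(M : ℝ) * x⌋ / M))) ∂ν := lintegral_mono' hcν le_rfl
      _ = ∫⁻ x, ENNReal.ofReal (-Real.log (r ⌊((1 : ℕ) : ℝ) * x⌋)) ∂ν := by
          simp only [floor_mul_ediv hM, Nat.cast_one, one_mul]
      _ = ∑' j, ENNReal.ofReal (-Real.log (r j)) * ν (cell 1 j) :=
          (tsum_mul_measure_cell ν 1 fun j => ENNReal.ofReal (-Real.log (r j))).symm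
      _ = cellEntropy ν 1 := by
          refine tsum_congr fun j => ?_
          rw [← ofReal_measureReal (μ := ν), ← ENNReal.ofReal_mul (hlog j), Real.negMulLog]
          congr 1; simp only [hr]; ring
  have h4 : ∑' k, ENNReal.ofReal (r (k / M)) * volume (cell M k) = 1 := by
    rw [tsum_mul_measure_cell volume M fun k => ENNReal.ofReal (r (k / M))]
    calc ∫⁻ x, ENNReal.ofReal (r (⌊(M : ℝ) * x⌋ / M))
        = ∫⁻ x, ENNReal.ofReal (r ⌊((1 : ℕ) : ℝ) * x⌋) := by
          simp only [floor_mul_ediv hM, Nat.cast_one, one_mul]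
      _ = ∑' j, ENNReal.ofReal (r j) * volume (cell 1 j) :=
          (tsum_mul_measure_cell volume 1 fun j => ENNReal.ofReal (r j)).symm
      _ = ∑' j, 1 * ν (cell 1 j) := by
          refine tsum_congr fun j => ?_
          rw [volume_cell one_ne_zero, hr, ofReal_measureReal]; simp
      _ = 1 := by
          rw [tsum_mul_measure_cell ν 1 fun _ => 1]; simp
  calc cellEntropy ν M ≤ _ := ENNReal.tsum_le_tsum hterm
    _ ≤ S.card + (ENNReal.ofReal (Real.log M) * νc univ + cellEntropy ν 1 + 1) := by
        rw [ENNReal.tsum_add, ENNReal.tsum_add, ENNReal.tsum_add, h2, h4]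
        gcongr
    _ = _ := by ring

/-- The union of the cells of probability at least `exp (√log M) / M`. -/
def heavyCells (ν : Measure ℝ) (M : ℕ) : Set ℝ :=
  {x | Real.exp (-(Real.log M - Real.sqrt (Real.log M))) ≤ ν.real (cell M ⌊(M : ℝ) * x⌋)}

theorem measurableSet_heavyCells (ν : Measure ℝ) (M : ℕ) : MeasurableSet (heavyCells ν M) :=
  measurable_floor_mul M (MeasurableSet.of_discrete (s := {k : ℤ |
    Real.exp (-(Real.log M - Real.sqrt (Real.log M))) ≤ ν.real (cell M k)}))

theorem lintegral_ite_floor (μ : Measure ℝ) (M : ℕ) (p : ℤ → Prop) [DecidablePred p] (c : ℝ≥0∞) :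
    ∫⁻ x, (if p ⌊(M : ℝ) * x⌋ then c else 0) ∂μ = c * μ {x | p ⌊(M : ℝ) * x⌋} := by
  have hs : MeasurableSet {x : ℝ | p ⌊(M : ℝ) * x⌋} :=
    measurable_floor_mul M (MeasurableSet.of_discrete (s := {k : ℤ | p k}))
  rw [← lintegral_indicator_const hs]
  refine lintegral_congr fun x => ?_
  by_cases hx : p ⌊(M : ℝ) * x⌋ <;> simp [indicator, hx]

/-- Markov's inequality: a heavy cell has volume `1/M ≤ exp(-√log M) ν(cell)`, and the `ν`-masses
sum to `1`. -/
theorem volume_heavyCells_le (ν : Measure ℝ) [IsProbabilityMeasure ν] {M : ℕ} (hM : M ≠ 0) :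
    volume (heavyCells ν M) ≤ ENNReal.ofReal (Real.exp (-Real.sqrt (Real.log M))) := by
  classical
  have hM' : (0 : ℝ) < M := by positivity
  set θ := Real.exp (-(Real.log M - Real.sqrt (Real.log M))) with hθ
  have hθM : (M : ℝ)⁻¹ = Real.exp (-Real.sqrt (Real.log M)) * θ := by
    rw [hθ, ← Real.exp_add, ← Real.exp_log hM', ← Real.exp_neg, Real.log_exp]; congr 1; ring
  have h := lintegral_ite_floor volume M (fun k => θ ≤ ν.real (cell M k)) 1
  rw [one_mul, ← tsum_mul_measure_cell volume M
    (fun k => if θ ≤ ν.real (cell M k) then 1 else 0)] at h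
  change volume {x | θ ≤ ν.real (cell M ⌊(M : ℝ) * x⌋)} ≤ _
  rw [← h]
  calc _ ≤ ∑' k, ENNReal.ofReal (Real.exp (-Real.sqrt (Real.log M))) * ν (cell M k) := by
        refine ENNReal.tsum_le_tsum fun k => ?_
        split_ifs with hk
        · rw [one_mul, volume_cell hM, hθM, ENNReal.ofReal_mul (Real.exp_nonneg _)]
          gcongr
          exact ENNReal.ofReal_le_of_le_toReal hk
        · simp
    _ = _ := by
        rw [tsum_mul_measure_cell ν M fun _ => ENNReal.ofReal (Real.exp (-Real.sqrt (Real.log M)))]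
        simp

/-- Each light cell of positive mass has `-log ν(cell) > log M - √log M`. -/
theorem le_cellEntropy (ν : Measure ℝ) [IsProbabilityMeasure ν] (M : ℕ) :
    ENNReal.ofReal (Real.log M - Real.sqrt (Real.log M)) * ν (heavyCells ν M)ᶜ ≤
      cellEntropy ν M := by
  classical
  set L := Real.log M - Real.sqrt (Real.log M) with hL
  have h := lintegral_ite_floor ν M (fun k => ¬ Real.exp (-L) ≤ ν.real (cell M k))
    (ENNReal.ofReal L)
  rw [← tsum_mul_measure_cell ν M
    (fun k => if ¬ Real.exp (-L) ≤ ν.real (cell M k) then ENNReal.ofReal L else 0)] at h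
  change ENNReal.ofReal L * ν {x | ¬ Real.exp (-L) ≤ ν.real (cell M ⌊(M : ℝ) * x⌋)} ≤ _
  rw [← h]
  refine ENNReal.tsum_le_tsum fun k => ?_
  split_ifs with hk
  · simp
  · push Not at hk
    rcases (measureReal_nonneg (μ := ν) (s := cell M k)).eq_or_lt with h0 | h0
    · have : ν (cell M k) = 0 := (measureReal_eq_zero_iff).1 h0.symm
      simp [this]
    · have h1 := Real.log_lt_log h0 hk
      rw [Real.log_exp] at h1
      rw [← ofReal_measureReal (μ := ν) (s := cell M k),
        ← ENNReal.ofReal_mul' measureReal_nonneg, Real.negMulLog]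
      refine ENNReal.ofReal_le_ofReal ?_
      nlinarith

/-- **Rényi's theorem**: the information dimension of the sum of a finitely supported measure and
an absolutely continuous one is the mass of the latter. -/
theorem hasInformationDimension_of_add {ν νd νc : Measure ℝ} [IsProbabilityMeasure ν]
    (hν : ν = νd + νc) {S : Finset ℝ} (hS : νd (↑S)ᶜ = 0) (hc : νc ≪ volume)
    (hH : cellEntropy ν 1 ≠ ⊤) : HasInformationDimension ν (νc univ) := by
  have hcν : νc ≤ ν := by rw [hν]; exact Measure.le_add_left le_rfl
  have : IsFiniteMeasure νc := isFiniteMeasure_of_le ν hcν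
  have hlog : Tendsto (fun M : ℕ => Real.log M) atTop atTop :=
    Real.tendsto_log_atTop.comp tendsto_natCast_atTop_atTop
  have hlogE : Tendsto (fun M : ℕ => ENNReal.ofReal (Real.log M)) atTop (𝓝 ⊤) :=
    ENNReal.tendsto_ofReal_atTop.comp hlog
  -- The margin `√log M` tends to infinity, so the heavy cells have vanishing volume and hence
  -- vanishing `νc`-mass; being `o(log M)`, it does not affect the leading order of the entropy.
  have hheavy : Tendsto (fun M => νc (heavyCells ν M)) atTop (𝓝 0) := by
    have hvol : Tendsto (volume ∘ heavyCells ν) atTop (𝓝 0) := by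
      have h1 : Tendsto (fun M : ℕ => ENNReal.ofReal (Real.exp (-Real.sqrt (Real.log M)))) atTop
          (𝓝 0) := by
        have h2 := Real.tendsto_exp_neg_atTop_nhds_zero.comp (Real.tendsto_sqrt_atTop.comp hlog)
        simpa [Function.comp_def] using (ENNReal.continuous_ofReal.tendsto 0).comp h2
      refine tendsto_of_tendsto_of_tendsto_of_le_of_le' tendsto_const_nhds h1
        (Eventually.of_forall fun _ => zero_le) ?_
      filter_upwards [eventually_ne_atTop 0] with M hM
      exact volume_heavyCells_le ν hM
    have h3 := tendsto_setLIntegral_zero (Measure.lintegral_rnDeriv_lt_top νc volume).ne hvol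
    simpa only [Measure.setLIntegral_rnDeriv hc] using h3
  have hupper : Tendsto (fun M : ℕ => (S.card + cellEntropy ν 1 + 1) / ENNReal.ofReal (Real.log M)
      + νc univ) atTop (𝓝 (νc univ)) := by
    have h1 := ENNReal.Tendsto.const_div (a := (S.card + cellEntropy ν 1 + 1 : ℝ≥0∞)) hlogE
      (Or.inr (by simp [hH]))
    simpa using h1.add_const (νc univ)
  have hlower : Tendsto (fun M : ℕ => ENNReal.ofReal (1 - 1 / Real.sqrt (Real.log M)) *
      (νc univ - νc (heavyCells ν M))) atTop (𝓝 (νc univ)) := by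
    have h1 : Tendsto (fun M : ℕ => 1 - 1 / Real.sqrt (Real.log M)) atTop (𝓝 1) := by
      have := (tendsto_const_nhds (x := (1 : ℝ))).div_atTop (Real.tendsto_sqrt_atTop.comp hlog)
      simpa using tendsto_const_nhds.sub this
    have h2 := ENNReal.Tendsto.sub (tendsto_const_nhds (x := νc univ)) hheavy
      (Or.inl (measure_ne_top _ _))
    have h3 := ENNReal.Tendsto.mul ((ENNReal.continuous_ofReal.tendsto 1).comp h1)
      (Or.inl (by simp)) h2 (Or.inr (by simp))
    simpa using h3
  refine tendsto_of_tendsto_of_tendsto_of_le_of_le' hlower hupper ?_ ?_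
  · filter_upwards [hlog.eventually_gt_atTop 0, eventually_ne_atTop 0] with M hM hM0
    rw [shannonEntropy_map_quantize ν hM0, ENNReal.le_div_iff_mul_le
      (Or.inl (ENNReal.ofReal_pos.2 hM).ne') (Or.inl ENNReal.ofReal_ne_top)]
    refine le_trans ?_ (le_cellEntropy ν M)
    have e : ENNReal.ofReal (Real.log M - Real.sqrt (Real.log M)) =
        ENNReal.ofReal (1 - 1 / Real.sqrt (Real.log M)) * ENNReal.ofReal (Real.log M) := by
      rw [← ENNReal.ofReal_mul' hM.le]
      congr 1
      have h2 := Real.sq_sqrt hM.le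
      have h3 : 0 < Real.sqrt (Real.log M) := Real.sqrt_pos.2 hM
      have h4 : 1 / Real.sqrt (Real.log M) * Real.log M = Real.sqrt (Real.log M) := by
        rw [one_div, inv_mul_eq_iff_eq_mul₀ h3.ne', ← sq, h2]
      rw [sub_mul, one_mul, h4]
    rw [e, mul_right_comm]
    gcongr
    rw [← measure_compl (measurableSet_heavyCells ν M) (measure_ne_top _ _)]
    exact hcν _
  · filter_upwards [hlog.eventually_gt_atTop 0, eventually_ne_atTop 0] with M hM hM0
    rw [shannonEntropy_map_quantize ν hM0]
    refine ENNReal.div_le_of_le_mul ((cellEntropy_le hν hS hM0).trans (le_of_eq ?_))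
    rw [add_mul, ENNReal.div_mul_cancel (ENNReal.ofReal_pos.2 hM).ne' ENNReal.ofReal_ne_top,
      mul_comm]

/-! ### The law of `f(Z)` for piecewise smooth `f` -/

theorem PiecewiseSmooth.exists_cover {f : ℝ → ℝ} (hf : PiecewiseSmooth f) :
    ∃ (K : ℕ) (I : Fin K → Set ℝ), (∀ i, (I i).OrdConnected) ∧ (⋃ i, I i) = univ ∧
      ∀ i, DifferentiableOn ℝ f (I i) ∧ (InjOn f (I i) ∨ ∃ c, ∀ x ∈ I i, f x = c) := by
  obtain ⟨K, I, hI, -, hcover, hsm⟩ := hf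
  refine ⟨K, I, hI, hcover, fun i => ⟨(hsm i).1.differentiableOn one_ne_zero, ?_⟩⟩
  rcases (hsm i).2 with h | h | h
  · exact Or.inl h.injOn
  · exact Or.inl h.injOn
  · exact Or.inr h

/-- An injective piece meets the flat set in at most one point: between two such points the first
value would be repeated. A constant piece contributes one value. -/
theorem PiecewiseSmooth.finite_image_flatSet {f : ℝ → ℝ} (hf : PiecewiseSmooth f) :
    (f '' flatSet f).Finite := by
  obtain ⟨K, I, hI, hcover, hI2⟩ := hf.exists_cover
  have e : flatSet f = ⋃ i, (flatSet f ∩ I i) := by rw [← inter_iUnion, hcover, inter_univ]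
  rw [e, image_iUnion]
  refine finite_iUnion fun i => ?_
  rcases (hI2 i).2 with hinj | ⟨c, hc⟩
  · refine (Subsingleton.finite ?_).image f
    have hlt : ∀ x ∈ flatSet f ∩ I i, ∀ y ∈ flatSet f ∩ I i, ¬ x < y := by
      intro x hx y hy hxy
      have hx' : ∀ᶠ u in 𝓝[>] x, f u = f x := nhdsWithin_le_nhds hx.1
      obtain ⟨u, hu, hu2⟩ := (hx'.and (Ioo_mem_nhdsGT hxy)).exists
      have huI : u ∈ I i := (hI i).out hx.2 hy.2 (Ioo_subset_Icc_self hu2)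
      exact hu2.1.ne' (hinj huI hx.2 hu)
    exact fun x hx y hy => le_antisymm (not_lt.1 (hlt y hy x hx)) (not_lt.1 (hlt x hx y hy))
  · refine (finite_singleton c).subset ?_
    rintro _ ⟨x, hx, rfl⟩
    exact hc x hx.2

/-- Boundaries of pieces are null, and interiors of constant pieces are flat. On an injective piece,
change of variables gives `∫ |f'| = 0` over the non-flat preimage of a null set, so `f' = 0` almost
everywhere there, and `CriticalOnlyOnFlat` makes it null. -/
theorem PiecewiseSmooth.absolutelyContinuous_map {f : ℝ → ℝ} (hf : PiecewiseSmooth f)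
    (hcrit : CriticalOnlyOnFlat f) :
    ((gaussianReal 0 1).restrict (flatSet f)ᶜ).map f ≪ volume := by
  have hfm := hf.measurable
  obtain ⟨K, I, hI, hcover, hI2⟩ := hf.exists_cover
  have hD : MeasurableSet (flatSet f)ᶜ := (isOpen_flatSet f).measurableSet.compl
  refine Measure.AbsolutelyContinuous.mk fun A hA hA0 => ?_
  rw [Measure.map_apply hfm hA, Measure.restrict_apply (hfm hA)]
  refine gaussianReal_absolutelyContinuous 0 one_ne_zero ?_
  have hsub : f ⁻¹' A ∩ (flatSet f)ᶜ ⊆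
      ⋃ i, (frontier (I i) ∪ (interior (I i) ∩ (f ⁻¹' A ∩ (flatSet f)ᶜ))) := by
    intro x hx
    obtain ⟨i, hi⟩ := mem_iUnion.1 (hcover.symm ▸ mem_univ x : x ∈ ⋃ i, I i)
    refine mem_iUnion.2 ⟨i, ?_⟩
    by_cases hxi : x ∈ interior (I i)
    · exact Or.inr ⟨hxi, hx⟩
    · exact Or.inl ⟨subset_closure hi, hxi⟩
  refine measure_mono_null hsub (measure_iUnion_null fun i => measure_union_null ?_ ?_)
  · exact (hI i).convex.addHaar_frontier volume
  set s := interior (I i) ∩ (f ⁻¹' A ∩ (flatSet f)ᶜ) with hs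
  have hsm : MeasurableSet s := isOpen_interior.measurableSet.inter ((hfm hA).inter hD)
  rcases (hI2 i).2 with hinj | ⟨c, hc⟩
  · have hderiv : ∀ x ∈ s, HasDerivWithinAt f (deriv f x) s x := fun x hx =>
      ((hI2 i).1.differentiableAt (mem_interior_iff_mem_nhds.1 hx.1)).hasDerivAt.hasDerivWithinAt
    have h := lintegral_image_eq_lintegral_abs_deriv_mul hsm hderiv
      (hinj.mono fun x hx => interior_subset hx.1) fun _ => 1
    have himg : volume (f '' s) = 0 :=
      measure_mono_null (image_subset_iff.2 fun x hx => hx.2.1) hA0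
    simp only [mul_one, lintegral_one, Measure.restrict_apply_univ, himg] at h
    have h2 := (lintegral_eq_zero_iff (by fun_prop)).1 h.symm
    have h3 : ∀ᵐ x ∂volume.restrict s, False := by
      filter_upwards [h2, ae_restrict_of_ae hcrit, ae_restrict_mem hsm] with x hx hx2 hx3
      have h0 : deriv f x = 0 := by simpa using hx
      exact hx3.2.2 (hx2 h0)
    rw [← Measure.restrict_apply_univ s]
    simpa [ae_iff] using h3
  · have : s = ∅ := by
      ext x
      simp only [mem_empty_iff_false, iff_false]
      intro hx
      refine hx.2.2 ?_
      change ∀ᶠ u in 𝓝 x, f u = f x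
      filter_upwards [mem_interior_iff_mem_nhds.1 hx.1] with u hu
      rw [hc u hu, hc x (interior_subset hx.1)]
    rw [this, measure_empty]

theorem PiecewiseSmooth.hasInformationDimension {f : ℝ → ℝ} (hf : PiecewiseSmooth f)
    (hcrit : CriticalOnlyOnFlat f)
    (hH : shannonEntropy ((gaussianReal 0 1).map (fun z => ⌊f z⌋)) ≠ ⊤) :
    HasInformationDimension ((gaussianReal 0 1).map f) (gaussianReal 0 1 (flatSet f)ᶜ) := by
  have hfm := hf.measurable
  have hD := (isOpen_flatSet f).measurableSet
  have hprob : IsProbabilityMeasure ((gaussianReal 0 1).map f) :=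
    Measure.isProbabilityMeasure_map hfm.aemeasurable
  have hsum : (gaussianReal 0 1).map f = ((gaussianReal 0 1).restrict (flatSet f)).map f +
      ((gaussianReal 0 1).restrict (flatSet f)ᶜ).map f := by
    rw [← Measure.map_add _ _ hfm, Measure.restrict_add_restrict_compl hD]
  rw [shannonEntropy_map_floor _ hfm] at hH
  have h := hasInformationDimension_of_add hsum (S := hf.finite_image_flatSet.toFinset) ?_
    (hf.absolutelyContinuous_map hcrit) hH
  · rwa [Measure.map_apply hfm MeasurableSet.univ, preimage_univ,
      Measure.restrict_apply_univ] at h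
  · rw [Finite.coe_toFinset, Measure.map_apply hfm
      hf.finite_image_flatSet.measurableSet.compl, Measure.restrict_apply
      (hfm hf.finite_image_flatSet.measurableSet.compl)]
    have : f ⁻¹' (f '' flatSet f)ᶜ ∩ flatSet f = ∅ := by
      ext x
      simp only [mem_inter_iff, mem_preimage, mem_compl_iff, mem_empty_iff_false, iff_false]
      exact fun hx => hx.1 (mem_image_of_mem f hx.2)
    rw [this, measure_empty]

end GLMEP

theorem mainTheorem7
    (f : ℝ → ℝ) (hf : GLMEP.PiecewiseSmooth f)
    (hH : GLMEP.shannonEntropy ((gaussianReal 0 1).map (fun z => ⌊f z⌋)) ≠ ⊤)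
    (Pl : Measure ℝ) [IsProbabilityMeasure Pl]
    (a b δ : ℝ) (ha : 0 < a) (hsupp : ∀ᵐ l ∂Pl, l ∈ Set.Icc a b)
    (hδ : 1 < δ) (hmean : ∫ l, l ∂Pl = δ)
    (Vl : ℕ → ℝ≥0∞) (Vr : ℕ → ℝ) (hSE : GLMEP.IsStateEvolution f Pl δ Vl Vr) :
    Tendsto (fun t => GLMEP.mse Pl (Vl t)) atTop (𝓝 (GLMEP.finalMSE f Pl δ)) ∧
    (GLMEP.finalMSE f Pl δ = 0 ↔ ∀ v ∈ Set.Ioc (0 : ℝ) 1, 0 < GLMEP.PFun f Pl δ v) ∧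
    (GLMEP.CriticalOnlyOnFlat f →
      ∃ d : ℝ≥0∞, GLMEP.HasInformationDimension ((gaussianReal 0 1).map f) d ∧
        ((∀ v ∈ Set.Ioc (0 : ℝ) 1, 0 < GLMEP.PFun f Pl δ v) → d⁻¹ ≤ ENNReal.ofReal δ)) := by
  have hfm := hf.measurable
  have h : GLMEP.AdmissibleLaw Pl a b δ := ⟨inferInstance, ha, hsupp, hδ, hmean⟩
  refine ⟨GLMEP.tendsto_mse_finalMSE h hfm hSE, GLMEP.finalMSE_eq_zero_iff h hfm, fun hcrit =>
    ⟨_, hf.hasInformationDimension hcrit hH, fun hP => ?_⟩⟩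
  have h1 := GLMEP.one_le_delta_mul_of_PFun_pos h hfm hP
  rw [← probReal_compl_eq_one_sub (GLMEP.isOpen_flatSet f).measurableSet] at h1
  -- Positivity of `P` already excludes `d = 0`, so `d⁻¹` is a genuine real inverse.
  have h2 : 0 < (gaussianReal 0 1).real (GLMEP.flatSet f)ᶜ :=
    pos_of_mul_pos_right (zero_lt_one.trans_le h1) h.pos_delta.le
  rw [← ofReal_measureReal, ← ENNReal.ofReal_inv_of_pos h2]
  refine ENNReal.ofReal_le_ofReal ?_
  rw [← one_div, div_le_iff₀ h2]
  exact h1
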